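/- Let $M$ be a complex manifold of dimension $2$ and $F:T'M\to[0,\infty)$ a complex Finsler metric on its holomorphic tangent bundle: $F$ is continuous, $L=F^2$ is smooth off the zero section, $F(v)=0$ iff $v=0$, $F(cv)=|c|F(v)$ for $c\in\mathbb C$, and in holomorphic coordinates $(z^k,\eta^k)$ the Hermitian matrix $g_{i\bar j}=\partial^2L/\partial\eta^i\partial\bar\eta^j$ is positive definite for $\eta\neq0$. In a chart write $\dot\partial_k=\partial/\partial\eta^k$, let $(g^{\bar m k})$ be the inverse of $(g_{i\bar j})$, $g=\det(g_{i\bar j})$, and (summing over repeated indices) $$N^k_j=g^{\bar mk}\frac{\partial g_{l\bar m}}{\partial z^j}\eta^l,\quad \delta_k=\frac{\partial}{\partial z^k}-N^j_k\dot\partial_j,\quad L^i_{jk}=g^{\bar li}\delta_kg_{j\bar l},\quad C^i_{jk}=g^{\bar li}\dot\partial_kg_{j\bar l}.$$ Let $l^i=\eta^i/F$, $l_i=g_{i\bar j}\bar\eta^j/F$, $m^1=-l_2/\sqrt g$, $m^2=l_1/\sqrt g$, $m_i=g_{i\bar j}\overline{m^j}$, and put $$A=m^jm^kl_hC^h_{kj},\quad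 B=m^jm^km_hC^h_{jk},$$ $$J=l^jl^kl_iL^i_{jk},\quad Y=m^jl^km_iL^i_{jk},\quad V=l^jm^kl_iL^i_{jk},\quad H=m^jm^km_iL^i_{jk}.$$ For a function $X$ of $(z,\eta)$ write $X_{|k}=\delta_kX$, $X|_k=\dot\partial_kX$, $X|_0=\eta^kX|_k$. (These quantities depend on the chart, but the vanishing of $A$ or of $B$ at a given vector does not.) Let $D$ be an open subset of $T'M\setminus\{0\}$ whose intersection with each fibre is connected or empty; for instance $D=T'M\setminus\{0\}$. Then at least one of the following holds. (i) $F$ is purely Hermitian on $D$: in every chart $g_{i\bar j}(z,\eta)=g_{i\bar j}(z,\eta')$ whenever $(z,\eta),(z,\eta')\in D$. (ii) $A$ is not identically zero on $D$, $B=0$ everywhere on $D$, and in every chart, at every point of $D$, $$(J+Y)|_sm^s=\frac1F(V+H),\qquad (V+H)|_sm^s=-A(J+Y).$$ (iii) $AB^2$ is not identically zero on $D$, and in every chart, at every point of $D$, $$(J+Y)|_0=\frac{J+Y}2,\qquad (V+H)|_0=-\frac{V+H}2,$$ $$B_{|k}=\Big[\frac B2(J+Y)+(J+Y)|_sm^s-\frac1F(V+H)\Big]l_k+\Big[B(V+H)+(V+H)|_sm^s+A(J+Y)\Big]m_k\qquad(k=1,2).$$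 -/

import Mathlib

open scoped Manifold ContDiff ComplexOrder

noncomputable section

namespace ComplexFinsler

/-- Complex coordinate space of dimension two (coordinates `z 0`, `z 1`). -/
abbrev C2 : Type := Fin 2 → ℂ

/-- Coordinate pairs `u = (z, η)`; `u.1 = z` is the base point, `u.2 = η` the fibre coordinate. -/
abbrev ZEta : Type := C2 × C2

/-! ### Wirtinger derivatives in the coordinates `(z, η)` -/

/-- Wirtinger derivative `(∂_v - i ∂_{iv}) / 2` of a real-differentiable function. -/
def wirt (v : ZEta) (f : ZEta → ℂ) (u : ZEta) : ℂ :=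
  (1 / 2 : ℂ) * (fderiv ℝ f u v - Complex.I * fderiv ℝ f u (Complex.I • v))

/-- Conjugate Wirtinger derivative `(∂_v + i ∂_{iv}) / 2`. -/
def wirtBar (v : ZEta) (f : ZEta → ℂ) (u : ZEta) : ℂ :=
  (1 / 2 : ℂ) * (fderiv ℝ f u v + Complex.I * fderiv ℝ f u (Complex.I • v))

/-- `∂ / ∂z^k`. -/
def dz (k : Fin 2) : (ZEta → ℂ) → ZEta → ℂ := wirt (Pi.single k 1, 0)

/-- `∂ / ∂η^k`. -/
def deta (k : Fin 2) : (ZEta → ℂ) → ZEta → ℂ := wirt (0, Pi.single k 1)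

/-- The derivative with respect to the complex conjugate of `η^k`. -/
def detaBar (k : Fin 2) : (ZEta → ℂ) → ZEta → ℂ := wirtBar (0, Pi.single k 1)

/-! ### The geometry of a complex Finsler function `f(z, η)` in one chart

In this part `f` is the coordinate expression of the Finsler function. A barred index is an
ordinary index of the Lean function. -/

/-- `L = f²`, as a complex-valued function. -/
def lagr (f : ZEta → ℝ) (u : ZEta) : ℂ := ((f u ^ 2 : ℝ) : ℂ)

/-- Fundamental metric tensor: `g f i j = ∂²L / ∂η^i ∂η̄^j`. -/
def g (f : ZEta → ℝ) (i j : Fin 2) : ZEta → ℂ := deta i (detaBar j (lagr f))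

/-- The matrix with entries `g_{i j̄}`. -/
def gMat (f : ZEta → ℝ) (u : ZEta) : Matrix (Fin 2) (Fin 2) ℂ := Matrix.of fun i j => g f i j u

/-- Inverse metric: `gInv f m k = g^{m̄ k}`, so that `∑ m, g_{l m̄} g^{m̄ k} = δ_l^k`. -/
def gInv (f : ZEta → ℝ) (m k : Fin 2) (u : ZEta) : ℂ := (gMat f u)⁻¹ m k

/-- The positive square root of `det (g_{i j̄})`. -/
def sqrtDet (f : ZEta → ℝ) (u : ZEta) : ℂ := ((Real.sqrt (gMat f u).det.re : ℝ) : ℂ)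

/-- Chern-Finsler nonlinear connection:
`N f k j = N_k^j = g^{m̄ j} (∂g_{l m̄} / ∂z^k) η^l`. -/
def N (f : ZEta → ℝ) (k j : Fin 2) (u : ZEta) : ℂ :=
  ∑ m, ∑ l, gInv f m j u * dz k (g f l m) u * u.2 l

/-- The adapted derivative `δ_k = ∂/∂z^k - N_k^j ∂/∂η^j`. On scalars it is the
horizontal covariant derivative. -/
def delta (f : ZEta → ℝ) (k : Fin 2) (h : ZEta → ℂ) (u : ZEta) : ℂ :=
  dz k h u - ∑ j, N f k j u * deta j h u

/-- Horizontal coefficients of the Chern-Finsler connection: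
`Lcoef f i j k = L_{jk}^i = g^{l̄ i} δ_k g_{j l̄}`. -/
def Lcoef (f : ZEta → ℝ) (i j k : Fin 2) (u : ZEta) : ℂ :=
  ∑ l, gInv f l i u * delta f k (g f j l) u

/-- Vertical coefficients of the Chern-Finsler connection:
`Ccoef f i j k = C_{jk}^i = g^{l̄ i} ∂g_{j l̄} / ∂η^k`. -/
def Ccoef (f : ZEta → ℝ) (i j k : Fin 2) (u : ZEta) : ℂ :=
  ∑ l, gInv f l i u * deta k (g f j l) u

/-! The local complex Berwald frame. -/

/-- `l^i = η^i / F`. -/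
def lUp (f : ZEta → ℝ) (i : Fin 2) (u : ZEta) : ℂ := u.2 i / (f u : ℂ)

/-- `l_i = g_{i j̄} η̄^j / F`. -/
def lDn (f : ZEta → ℝ) (i : Fin 2) (u : ZEta) : ℂ :=
  (∑ j, g f i j u * (starRingEnd ℂ) (u.2 j)) / (f u : ℂ)

/-- `m^1 = -l_2 / √g`, `m^2 = l_1 / √g`. -/
def mUp (f : ZEta → ℝ) (i : Fin 2) (u : ZEta) : ℂ :=
  (![-lDn f 1 u, lDn f 0 u] i) / sqrtDet f u

/-- `m_i = g_{i j̄} m^{j̄}`. -/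
def mDn (f : ZEta → ℝ) (i : Fin 2) (u : ZEta) : ℂ :=
  ∑ j, g f i j u * (starRingEnd ℂ) (mUp f j u)

/-! The vertical terms. -/

/-- `A = m^j m^k l_h C_{kj}^h`. -/
def A (f : ZEta → ℝ) (u : ZEta) : ℂ :=
  ∑ h, ∑ j, ∑ k, mUp f j u * mUp f k u * lDn f h u * Ccoef f h k j u

/-- `B = m_h m^k m^j C_{jk}^h`. -/
def B (f : ZEta → ℝ) (u : ZEta) : ℂ :=
  ∑ h, ∑ j, ∑ k, mDn f h u * mUp f k u * mUp f j u * Ccoef f h j k u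

/-! The horizontal terms that occur in the classification. -/

/-- `J = l^j l^k l_i L_{jk}^i`. -/
def J (f : ZEta → ℝ) (u : ZEta) : ℂ :=
  ∑ i, ∑ j, ∑ k, lUp f j u * lUp f k u * lDn f i u * Lcoef f i j k u

/-- `V = l^j m^k l_i L_{jk}^i`. -/
def V (f : ZEta → ℝ) (u : ZEta) : ℂ :=
  ∑ i, ∑ j, ∑ k, lUp f j u * mUp f k u * lDn f i u * Lcoef f i j k u

/-- `Y = m^j l^k m_i L_{jk}^i`. -/
def Y (f : ZEta → ℝ) (u : ZEta) : ℂ :=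
  ∑ i, ∑ j, ∑ k, mUp f j u * lUp f k u * mDn f i u * Lcoef f i j k u

/-- `H = m^j m^k m_i L_{jk}^i`. -/
def H (f : ZEta → ℝ) (u : ZEta) : ℂ :=
  ∑ i, ∑ j, ∑ k, mUp f j u * mUp f k u * mDn f i u * Lcoef f i j k u

/-- The sum `J + Y`. -/
def JY (f : ZEta → ℝ) (u : ZEta) : ℂ := J f u + Y f u

/-- The sum `V + H`. -/
def VH (f : ZEta → ℝ) (u : ZEta) : ℂ := V f u + H f u

/-- `h|_s m^s`: vertical derivative of a scalar, contracted with `m`. -/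
def vertM (f : ZEta → ℝ) (h : ZEta → ℂ) (u : ZEta) : ℂ := ∑ s, deta s h u * mUp f s u

/-- `h|_0 = h|_s η^s`: vertical derivative of a scalar, contracted with `η`. -/
def vertEta (h : ZEta → ℂ) (u : ZEta) : ℂ := ∑ s, deta s h u * u.2 s

/-! ### Complex Finsler metrics on a complex surface -/

section Manifold

variable {M : Type*} [TopologicalSpace M] [ChartedSpace C2 M]

/-- The tangent vector `η^k ∂/∂z^k` at the point with coordinates `z` in the chart `e`. -/
def tvec (e : OpenPartialHomeomorph M C2) (u : ZEta) : TangentBundle 𝓘(ℂ, C2) M :=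
  ⟨e.symm u.1, mfderiv 𝓘(ℂ, C2) 𝓘(ℂ, C2) e.symm u.1 u.2⟩

/-- The coordinate expression `F(z, η)` in the chart `e`. -/
def coordF (F : TangentBundle 𝓘(ℂ, C2) M → ℝ) (e : OpenPartialHomeomorph M C2) (u : ZEta) : ℝ :=
  F (tvec e u)

variable (M) in
/-- All holomorphic charts of `M`. -/
def charts : Set (OpenPartialHomeomorph M C2) := IsManifold.maximalAtlas 𝓘(ℂ, C2) ω M

/-- The coordinates `(z, η)`, in the chart `e`, of the vectors that belong to `D`. -/
def coordSet (e : OpenPartialHomeomorph M C2) (D : Set (TangentBundle 𝓘(ℂ, C2) M)) : Set ZEta :=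
  {u | u.1 ∈ e.target ∧ tvec e u ∈ D}

/-- `F` is a complex Finsler metric on the two-dimensional complex manifold `M`. -/
structure IsComplexFinsler [IsManifold 𝓘(ℂ, C2) ω M]
    (F : TangentBundle 𝓘(ℂ, C2) M → ℝ) : Prop where
  continuous : Continuous F
  /-- `L = F²` is (real) smooth off the zero section. -/
  smooth : ∀ e ∈ charts M,
    ContDiffOn ℝ ∞ (fun u : ZEta => coordF F e u ^ 2) (e.target ×ˢ {η : C2 | η ≠ 0})
  nonneg : ∀ v, 0 ≤ F v
  eq_zero_iff : ∀ (p : M) (v : TangentSpace 𝓘(ℂ, C2) p), F ⟨p, v⟩ = 0 ↔ v = 0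
  homogeneous : ∀ (p : M) (v : TangentSpace 𝓘(ℂ, C2) p) (c : ℂ), F ⟨p, c • v⟩ = ‖c‖ * F ⟨p, v⟩
  /-- strong pseudoconvexity -/
  posDef : ∀ e ∈ charts M, ∀ z ∈ e.target, ∀ η : C2, η ≠ 0 → (gMat (coordF F e) (z, η)).PosDef

/-- On `D` the fundamental tensor does not depend on the fibre coordinate:
`g_{i j̄}(z, η) = g_{i j̄}(z)`. -/
def IsPurelyHermitianOn (F : TangentBundle 𝓘(ℂ, C2) M → ℝ)
    (D : Set (TangentBundle 𝓘(ℂ, C2) M)) : Prop :=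
  ∀ e ∈ charts M, ∀ z η η' : C2, (z, η) ∈ coordSet e D → (z, η') ∈ coordSet e D →
    ∀ i j, g (coordF F e) i j (z, η) = g (coordF F e) i j (z, η')

end Manifold

end ComplexFinsler

end

open ComplexFinsler

namespace ComplexFinsler

open Filter Topology

/-! ### Derivations at a point and Wirtinger calculus -/

/-- `X` is a complex derivation, at the point `u`, of the germs of real-differentiable functions. -/
structure IsDerivationAt (u : ZEta) (X : (ZEta → ℂ) → ℂ) : Prop where
  congr : ∀ {h k : ZEta → ℂ}, h =ᶠ[𝓝 u] k → X h = X k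
  const : ∀ c : ℂ, X (fun _ => c) = 0
  add : ∀ {h k : ZEta → ℂ}, DifferentiableAt ℝ h u → DifferentiableAt ℝ k u →
    X (fun x => h x + k x) = X h + X k
  mul : ∀ {h k : ZEta → ℂ}, DifferentiableAt ℝ h u → DifferentiableAt ℝ k u →
    X (fun x => h x * k x) = X h * k u + h u * X k

namespace IsDerivationAt

variable {u : ZEta} {X X' : (ZEta → ℂ) → ℂ} {h k : ZEta → ℂ}

theorem const_mul_left (hX : IsDerivationAt u X) (c : ℂ) :
    IsDerivationAt u (fun h => c * X h) where
  congr e := by rw [hX.congr e]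
  const a := by rw [hX.const a, mul_zero]
  add hh hk := by rw [hX.add hh hk]; ring
  mul hh hk := by rw [hX.mul hh hk]; ring

theorem add_left (hX : IsDerivationAt u X) (hX' : IsDerivationAt u X') :
    IsDerivationAt u (fun h => X h + X' h) where
  congr e := by rw [hX.congr e, hX'.congr e]
  const a := by rw [hX.const a, hX'.const a, add_zero]
  add hh hk := by rw [hX.add hh hk, hX'.add hh hk]; ring
  mul hh hk := by rw [hX.mul hh hk, hX'.mul hh hk]; ring

theorem const_mul (hX : IsDerivationAt u X) (c : ℂ) (hh : DifferentiableAt ℝ h u) :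
    X (fun x => c * h x) = c * X h := by
  rw [hX.mul (differentiableAt_const c) hh, hX.const]; ring

theorem neg (hX : IsDerivationAt u X) (hh : DifferentiableAt ℝ h u) :
    X (fun x => -h x) = -X h := by
  have := hX.const_mul (-1) hh
  simpa using this

theorem sub (hX : IsDerivationAt u X) (hh : DifferentiableAt ℝ h u)
    (hk : DifferentiableAt ℝ k u) : X (fun x => h x - k x) = X h - X k := by
  have := hX.add hh hk.neg
  rw [show X (-k) = -X k from hX.neg hk] at this
  simpa [sub_eq_add_neg] using this

theorem inv (hX : IsDerivationAt u X) (hh : DifferentiableAt ℝ h u) (h0 : h u ≠ 0) :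
    X (fun x => (h x)⁻¹) = -X h / h u ^ 2 := by
  have h1 : X (fun x => h x * (h x)⁻¹) = 0 := by
    rw [← hX.const 1]
    apply hX.congr
    filter_upwards [hh.continuousAt.eventually_ne h0] with x hx
    exact mul_inv_cancel₀ hx
  rw [hX.mul hh (hh.fun_inv h0)] at h1
  field_simp
  field_simp at h1
  linear_combination h1

theorem div (hX : IsDerivationAt u X) (hh : DifferentiableAt ℝ h u)
    (hk : DifferentiableAt ℝ k u) (h0 : k u ≠ 0) :
    X (fun x => h x / k x) = X h / k u - h u * X k / k u ^ 2 := by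
  simp only [div_eq_mul_inv]
  rw [hX.mul hh (hk.fun_inv h0), hX.inv hk h0]
  ring

theorem of_sq_eq (hX : IsDerivationAt u X) (hh : DifferentiableAt ℝ h u) (h0 : h u ≠ 0)
    (e : (fun x => h x ^ 2) =ᶠ[𝓝 u] k) : X h = X k / (2 * h u) := by
  rw [← hX.congr e]
  simp only [sq]
  rw [hX.mul hh hh]
  field_simp
  ring

end IsDerivationAt

theorem isDerivationAt_fderiv (v u : ZEta) : IsDerivationAt u (fun h => fderiv ℝ h u v) where
  congr e := by rw [e.fderiv_eq]
  const c := by simp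
  add hh hk := by rw [fderiv_fun_add hh hk]; rfl
  mul hh hk := by
    rw [fderiv_fun_mul hh hk]
    simp
    ring

theorem wirt_eq (v : ZEta) (f : ZEta → ℂ) (u : ZEta) :
    wirt v f u = (1 / 2 : ℂ) * fderiv ℝ f u v
      + (-(1 / 2 : ℂ) * Complex.I) * fderiv ℝ f u (Complex.I • v) := by
  unfold wirt; ring

theorem wirtBar_eq (v : ZEta) (f : ZEta → ℂ) (u : ZEta) :
    wirtBar v f u = (1 / 2 : ℂ) * fderiv ℝ f u v
      + ((1 / 2 : ℂ) * Complex.I) * fderiv ℝ f u (Complex.I • v) := by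
  unfold wirtBar; ring

theorem isDerivationAt_wirt (v u : ZEta) : IsDerivationAt u (fun h => wirt v h u) := by
  simp only [wirt_eq]
  exact ((isDerivationAt_fderiv _ u).const_mul_left _).add_left
    ((isDerivationAt_fderiv _ u).const_mul_left _)

theorem isDerivationAt_wirtBar (v u : ZEta) : IsDerivationAt u (fun h => wirtBar v h u) := by
  simp only [wirtBar_eq]
  exact ((isDerivationAt_fderiv _ u).const_mul_left _).add_left
    ((isDerivationAt_fderiv _ u).const_mul_left _)

theorem isDerivationAt_dz (k : Fin 2) (u : ZEta) : IsDerivationAt u (fun h => dz k h u) :=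
  isDerivationAt_wirt _ u

theorem isDerivationAt_deta (k : Fin 2) (u : ZEta) : IsDerivationAt u (fun h => deta k h u) :=
  isDerivationAt_wirt _ u

theorem isDerivationAt_detaBar (k : Fin 2) (u : ZEta) :
    IsDerivationAt u (fun h => detaBar k h u) :=
  isDerivationAt_wirtBar _ u

theorem delta_eq (f : ZEta → ℝ) (k : Fin 2) (h : ZEta → ℂ) (u : ZEta) :
    delta f k h u = dz k h u - (N f k 0 u * deta 0 h u + N f k 1 u * deta 1 h u) := by
  simp [delta]

theorem isDerivationAt_delta (f : ZEta → ℝ) (k : Fin 2) (u : ZEta) :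
    IsDerivationAt u (fun h => delta f k h u) := by
  have : (fun h => delta f k h u) = fun h => dz k h u +
      ((-N f k 0 u) * deta 0 h u + (-N f k 1 u) * deta 1 h u) := by
    funext h; rw [delta_eq]; ring
  rw [this]
  exact (isDerivationAt_dz k u).add_left (((isDerivationAt_deta 0 u).const_mul_left _).add_left
    ((isDerivationAt_deta 1 u).const_mul_left _))

theorem vertM_eq (f : ZEta → ℝ) (h : ZEta → ℂ) (u : ZEta) :
    vertM f h u = mUp f 0 u * deta 0 h u + mUp f 1 u * deta 1 h u := by
  simp [vertM, mul_comm]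

theorem vertEta_eq (h : ZEta → ℂ) (u : ZEta) :
    vertEta h u = u.2 0 * deta 0 h u + u.2 1 * deta 1 h u := by
  simp [vertEta, mul_comm]

theorem isDerivationAt_vertM (f : ZEta → ℝ) (u : ZEta) :
    IsDerivationAt u (fun h => vertM f h u) := by
  simp only [vertM_eq]
  exact ((isDerivationAt_deta 0 u).const_mul_left _).add_left
    ((isDerivationAt_deta 1 u).const_mul_left _)

theorem isDerivationAt_vertEta (u : ZEta) : IsDerivationAt u (fun h => vertEta h u) := by
  simp only [vertEta_eq]
  exact ((isDerivationAt_deta 0 u).const_mul_left _).add_left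
    ((isDerivationAt_deta 1 u).const_mul_left _)

/-! Smoothness and second derivatives. -/

theorem _root_.ContDiffOn.differentiableAt_of_mem {U : Set ZEta} {h : ZEta → ℂ}
    (hh : ContDiffOn ℝ ∞ h U) (hU : IsOpen U) {u : ZEta} (hu : u ∈ U) :
    DifferentiableAt ℝ h u :=
  (hh.contDiffAt (hU.mem_nhds hu)).differentiableAt (by simp)

theorem _root_.ContDiffOn.fderiv_apply_const {U : Set ZEta} {h : ZEta → ℂ}
    (hh : ContDiffOn ℝ ∞ h U) (hU : IsOpen U) (v : ZEta) :
    ContDiffOn ℝ ∞ (fun x => fderiv ℝ h x v) U :=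
  (hh.fderiv_of_isOpen hU (by simp)).clm_apply contDiffOn_const

theorem _root_.ContDiffOn.wirt {U : Set ZEta} {h : ZEta → ℂ} (hh : ContDiffOn ℝ ∞ h U)
    (hU : IsOpen U) (v : ZEta) : ContDiffOn ℝ ∞ (ComplexFinsler.wirt v h) U := by
  have : ComplexFinsler.wirt v h = _ := funext (wirt_eq v h)
  rw [this]
  exact (contDiffOn_const.mul (hh.fderiv_apply_const hU _)).add
    (contDiffOn_const.mul (hh.fderiv_apply_const hU _))

theorem _root_.ContDiffOn.wirtBar {U : Set ZEta} {h : ZEta → ℂ} (hh : ContDiffOn ℝ ∞ h U)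
    (hU : IsOpen U) (v : ZEta) : ContDiffOn ℝ ∞ (ComplexFinsler.wirtBar v h) U := by
  have : ComplexFinsler.wirtBar v h = _ := funext (wirtBar_eq v h)
  rw [this]
  exact (contDiffOn_const.mul (hh.fderiv_apply_const hU _)).add
    (contDiffOn_const.mul (hh.fderiv_apply_const hU _))

theorem _root_.ContDiffOn.dz {U : Set ZEta} {h : ZEta → ℂ} (hh : ContDiffOn ℝ ∞ h U)
    (hU : IsOpen U) (k : Fin 2) : ContDiffOn ℝ ∞ (ComplexFinsler.dz k h) U := hh.wirt hU _

theorem _root_.ContDiffOn.deta {U : Set ZEta} {h : ZEta → ℂ} (hh : ContDiffOn ℝ ∞ h U)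
    (hU : IsOpen U) (k : Fin 2) : ContDiffOn ℝ ∞ (ComplexFinsler.deta k h) U := hh.wirt hU _

theorem _root_.ContDiffOn.detaBar {U : Set ZEta} {h : ZEta → ℂ} (hh : ContDiffOn ℝ ∞ h U)
    (hU : IsOpen U) (k : Fin 2) : ContDiffOn ℝ ∞ (ComplexFinsler.detaBar k h) U := hh.wirtBar hU _

theorem fderiv_fderiv_comm {U : Set ZEta} {h : ZEta → ℂ} (hh : ContDiffOn ℝ ∞ h U)
    (hU : IsOpen U) {u : ZEta} (hu : u ∈ U) (v w : ZEta) :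
    fderiv ℝ (fun x => fderiv ℝ h x w) u v = fderiv ℝ (fun x => fderiv ℝ h x v) u w := by
  have hc := hh.contDiffAt (hU.mem_nhds hu)
  have hd : DifferentiableAt ℝ (fderiv ℝ h) u :=
    (hc.fderiv_right (m := ∞) (by simp)).differentiableAt (by simp)
  have hs : IsSymmSndFDerivAt ℝ h u := hc.isSymmSndFDerivAt
    (by rw [minSmoothness_of_isRCLikeNormedField]; exact WithTop.coe_le_coe.2 le_top)
  have key : ∀ w v : ZEta, fderiv ℝ (fun x => fderiv ℝ h x w) u v =
      fderiv ℝ (fderiv ℝ h) u v w := by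
    intro w v
    rw [fderiv_clm_apply hd (differentiableAt_const w)]
    simp
  rw [key, key]
  exact hs v w

section Commutation

variable {U : Set ZEta} {h : ZEta → ℂ} {u : ZEta}

theorem IsDerivationAt.wirt_apply {X : (ZEta → ℂ) → ℂ} (hX : IsDerivationAt u X)
    (hh : ContDiffOn ℝ ∞ h U) (hU : IsOpen U) (hu : u ∈ U) (w : ZEta) :
    X (wirt w h) = (1 / 2 : ℂ) * X (fun x => fderiv ℝ h x w)
      + (-(1 / 2 : ℂ) * Complex.I) * X (fun x => fderiv ℝ h x (Complex.I • w)) := by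
  have d := fun w => (hh.fderiv_apply_const hU w).differentiableAt_of_mem hU hu
  rw [show wirt w h = _ from funext (wirt_eq w h),
    hX.add ((d _).const_mul _) ((d _).const_mul _), hX.const_mul _ (d _), hX.const_mul _ (d _)]

theorem IsDerivationAt.wirtBar_apply {X : (ZEta → ℂ) → ℂ} (hX : IsDerivationAt u X)
    (hh : ContDiffOn ℝ ∞ h U) (hU : IsOpen U) (hu : u ∈ U) (w : ZEta) :
    X (wirtBar w h) = (1 / 2 : ℂ) * X (fun x => fderiv ℝ h x w)
      + ((1 / 2 : ℂ) * Complex.I) * X (fun x => fderiv ℝ h x (Complex.I • w)) := by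
  have d := fun w => (hh.fderiv_apply_const hU w).differentiableAt_of_mem hU hu
  rw [show wirtBar w h = _ from funext (wirtBar_eq w h),
    hX.add ((d _).const_mul _) ((d _).const_mul _), hX.const_mul _ (d _), hX.const_mul _ (d _)]

theorem wirt_wirt_comm (hh : ContDiffOn ℝ ∞ h U) (hU : IsOpen U) (hu : u ∈ U) (v w : ZEta) :
    wirt v (wirt w h) u = wirt w (wirt v h) u := by
  rw [(isDerivationAt_wirt v u).wirt_apply hh hU hu, (isDerivationAt_wirt w u).wirt_apply hh hU hu]
  simp only [wirt_eq]
  rw [fderiv_fderiv_comm hh hU hu v w, fderiv_fderiv_comm hh hU hu (Complex.I • v) w,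
    fderiv_fderiv_comm hh hU hu v (Complex.I • w),
    fderiv_fderiv_comm hh hU hu (Complex.I • v) (Complex.I • w)]
  ring

theorem wirt_wirtBar_comm (hh : ContDiffOn ℝ ∞ h U) (hU : IsOpen U) (hu : u ∈ U) (v w : ZEta) :
    wirt v (wirtBar w h) u = wirtBar w (wirt v h) u := by
  rw [(isDerivationAt_wirt v u).wirtBar_apply hh hU hu,
    (isDerivationAt_wirtBar w u).wirt_apply hh hU hu]
  simp only [wirt_eq, wirtBar_eq]
  rw [fderiv_fderiv_comm hh hU hu v w, fderiv_fderiv_comm hh hU hu (Complex.I • v) w,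
    fderiv_fderiv_comm hh hU hu v (Complex.I • w),
    fderiv_fderiv_comm hh hU hu (Complex.I • v) (Complex.I • w)]
  ring

theorem wirt_add_wirtBar (v : ZEta) (h : ZEta → ℂ) (u : ZEta) :
    wirt v h u + wirtBar v h u = fderiv ℝ h u v := by
  unfold wirt wirtBar; ring

theorem wirtBar_conj (v : ZEta) (hh : DifferentiableAt ℝ h u) :
    wirtBar v (fun x => (starRingEnd ℂ) (h x)) u = (starRingEnd ℂ) (wirt v h u) := by
  have : fderiv ℝ (fun x => (starRingEnd ℂ) (h x)) u
      = (Complex.conjCLE : ℂ →L[ℝ] ℂ).comp (fderiv ℝ h u) :=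
    ((Complex.conjCLE : ℂ →L[ℝ] ℂ).hasFDerivAt.comp u hh.hasFDerivAt).fderiv
  simp [wirt, wirtBar, this, Complex.conj_ofNat]

theorem wirt_log (v : ZEta) (hh : DifferentiableAt ℝ h u) (h0 : h u ∈ Complex.slitPlane) :
    wirt v (fun x => Complex.log (h x)) u = wirt v h u / h u := by
  have key : ∀ w, fderiv ℝ (fun x => Complex.log (h x)) u w = (h u)⁻¹ * fderiv ℝ h u w := by
    intro w
    have := (((Complex.hasStrictDerivAt_log h0).hasDerivAt.hasFDerivAt.restrictScalars ℝ).comp u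
      hh.hasFDerivAt).fderiv
    simp only [Function.comp_def] at this
    rw [this]
    simp [mul_comm]
  simp only [wirt, key]
  ring

end Commutation

/-! Derivatives of the fibre coordinates. -/

theorem fderiv_coord (i : Fin 2) (u v : ZEta) : fderiv ℝ (fun x : ZEta => x.2 i) u v = v.2 i :=
  congrArg (fun T : ZEta →L[ℝ] ℂ => T v)
    (((ContinuousLinearMap.proj (R := ℝ) (φ := fun _ : Fin 2 => ℂ) i).comp
      (ContinuousLinearMap.snd ℝ C2 C2)).hasFDerivAt (x := u)).fderiv

theorem fderiv_conj_coord (i : Fin 2) (u v : ZEta) :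
    fderiv ℝ (fun x : ZEta => (starRingEnd ℂ) (x.2 i)) u v = (starRingEnd ℂ) (v.2 i) :=
  congrArg (fun T : ZEta →L[ℝ] ℂ => T v)
    (((Complex.conjCLE : ℂ →L[ℝ] ℂ).comp ((ContinuousLinearMap.proj (R := ℝ)
      (φ := fun _ : Fin 2 => ℂ) i).comp (ContinuousLinearMap.snd ℝ C2 C2))).hasFDerivAt
      (x := u)).fderiv

theorem contDiff_coord (i : Fin 2) : ContDiff ℝ ∞ (fun x : ZEta => x.2 i) :=
  ((ContinuousLinearMap.proj (R := ℝ) (φ := fun _ : Fin 2 => ℂ) i).comp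
    (ContinuousLinearMap.snd ℝ C2 C2)).contDiff

theorem contDiff_conj_coord (i : Fin 2) :
    ContDiff ℝ ∞ (fun x : ZEta => (starRingEnd ℂ) (x.2 i)) :=
  ((Complex.conjCLE : ℂ →L[ℝ] ℂ).comp ((ContinuousLinearMap.proj (R := ℝ)
    (φ := fun _ : Fin 2 => ℂ) i).comp (ContinuousLinearMap.snd ℝ C2 C2))).contDiff

theorem differentiableAt_coord (i : Fin 2) (u : ZEta) :
    DifferentiableAt ℝ (fun x : ZEta => x.2 i) u :=
  (contDiff_coord i).contDiffAt.differentiableAt (by simp)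

theorem differentiableAt_conj_coord (i : Fin 2) (u : ZEta) :
    DifferentiableAt ℝ (fun x : ZEta => (starRingEnd ℂ) (x.2 i)) u :=
  (contDiff_conj_coord i).contDiffAt.differentiableAt (by simp)

theorem deta_coord (k i : Fin 2) (u : ZEta) :
    deta k (fun x => x.2 i) u = if i = k then 1 else 0 := by
  simp only [deta, wirt, fderiv_coord]
  by_cases h : i = k
  · subst h; simp; norm_num
  · simp [h]

theorem detaBar_coord (k i : Fin 2) (u : ZEta) : detaBar k (fun x => x.2 i) u = 0 := by
  simp only [detaBar, wirtBar, fderiv_coord]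
  by_cases h : i = k
  · subst h; simp
  · simp [h]

theorem deta_conj_coord (k i : Fin 2) (u : ZEta) :
    deta k (fun x => (starRingEnd ℂ) (x.2 i)) u = 0 := by
  simp only [deta, wirt, fderiv_conj_coord]
  by_cases h : i = k
  · subst h; simp
  · simp [h]

theorem dz_coord (k i : Fin 2) (u : ZEta) : dz k (fun x => x.2 i) u = 0 := by
  simp [dz, wirt, fderiv_coord]

theorem dz_conj_coord (k i : Fin 2) (u : ZEta) :
    dz k (fun x => (starRingEnd ℂ) (x.2 i)) u = 0 := by
  simp [dz, wirt, fderiv_conj_coord]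

theorem delta_coord (f : ZEta → ℝ) (k i : Fin 2) (u : ZEta) :
    delta f k (fun x => x.2 i) u = -N f k i u := by
  rw [delta_eq, dz_coord, deta_coord, deta_coord]
  fin_cases i <;> simp

end ComplexFinsler

noncomputable section

namespace ComplexFinsler

open Filter Topology

/-! ### Complex Finsler functions in coordinates -/

/-- `f` is the coordinate expression of a complex Finsler function over the open set `U`. -/
structure IsLocalFinsler (f : ZEta → ℝ) (U : Set ZEta) : Prop where
  isOpen : IsOpen U
  smooth : ContDiffOn ℝ ∞ (fun u => f u ^ 2) U
  pos : ∀ u ∈ U, 0 < f u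
  homogeneous : ∀ u ∈ U, ∀ c : ℂ, f (u.1, c • u.2) = ‖c‖ * f u
  posDef : ∀ u ∈ U, (gMat f u).PosDef

theorem IsDerivationAt.congr_of_mem {U : Set ZEta} {u : ZEta} {X : (ZEta → ℂ) → ℂ}
    (hX : IsDerivationAt u X) (hU : IsOpen U) (hu : u ∈ U) {h k : ZEta → ℂ}
    (e : ∀ x ∈ U, h x = k x) : X h = X k :=
  hX.congr (by filter_upwards [hU.mem_nhds hu] with x hx using e x hx)

theorem IsDerivationAt.mul_add_mul {u : ZEta} {X : (ZEta → ℂ) → ℂ} (hX : IsDerivationAt u X)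
    {a b c d : ZEta → ℂ} (ha : DifferentiableAt ℝ a u) (hb : DifferentiableAt ℝ b u)
    (hc : DifferentiableAt ℝ c u) (hd : DifferentiableAt ℝ d u) :
    X (fun x => a x * b x + c x * d x)
      = X a * b u + a u * X b + (X c * d u + c u * X d) := by
  rw [hX.add (ha.fun_mul hb) (hc.fun_mul hd), hX.mul ha hb, hX.mul hc hd]

theorem wirt_add_left (v w : ZEta) (h : ZEta → ℂ) (u : ZEta) :
    wirt (v + w) h u = wirt v h u + wirt w h u := by
  simp only [wirt, smul_add, map_add]; ring

theorem wirtBar_add_left (v w : ZEta) (h : ZEta → ℂ) (u : ZEta) :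
    wirtBar (v + w) h u = wirtBar v h u + wirtBar w h u := by
  simp only [wirtBar, smul_add, map_add]; ring

theorem map_complex_smul (T : ZEta →L[ℝ] ℂ) (c : ℂ) (v : ZEta) :
    T (c • v) = c.re * T v + c.im * T (Complex.I • v) := by
  have : c • v = c.re • v + c.im • (Complex.I • v) := by
    conv_lhs => rw [← Complex.re_add_im c]
    rw [add_smul, mul_smul, Complex.coe_smul, Complex.coe_smul]
  rw [this, map_add, map_smul, map_smul, Complex.real_smul, Complex.real_smul]

theorem wirt_smul_left (c : ℂ) (v : ZEta) (h : ZEta → ℂ) (u : ZEta) :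
    wirt (c • v) h u = c * wirt v h u := by
  simp only [wirt, smul_smul, map_complex_smul _ c v, map_complex_smul _ (Complex.I * c) v]
  simp
  linear_combination (c.im / 2 * fderiv ℝ h u (Complex.I • v)) * Complex.I_sq
    + (1 / 2 * (fderiv ℝ h u v - Complex.I * fderiv ℝ h u (Complex.I • v))) * Complex.re_add_im c

theorem wirtBar_smul_left (c : ℂ) (v : ZEta) (h : ZEta → ℂ) (u : ZEta) :
    wirtBar (c • v) h u = (starRingEnd ℂ) c * wirtBar v h u := by
  simp only [wirtBar, smul_smul, map_complex_smul _ c v, map_complex_smul _ (Complex.I * c) v]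
  have : (starRingEnd ℂ) c = c.re - c.im * Complex.I := by
    apply Complex.ext <;> simp
  rw [this]
  simp
  linear_combination ((c.im / 2) * fderiv ℝ h u (Complex.I • v)) * Complex.I_sq

theorem fibre_vector_eq (η : C2) : ((0, η) : ZEta)
    = η 0 • ((0, Pi.single 0 1) : ZEta) + η 1 • ((0, Pi.single 1 1) : ZEta) := by
  ext i
  · simp
  · fin_cases i <;> simp

theorem wirt_fibre (η : C2) (h : ZEta → ℂ) (u : ZEta) :
    wirt (0, η) h u = η 0 * deta 0 h u + η 1 * deta 1 h u := by
  rw [fibre_vector_eq, wirt_add_left, wirt_smul_left, wirt_smul_left]; rfl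

theorem wirtBar_fibre (η : C2) (h : ZEta → ℂ) (u : ZEta) :
    wirtBar (0, η) h u = (starRingEnd ℂ) (η 0) * detaBar 0 h u
      + (starRingEnd ℂ) (η 1) * detaBar 1 h u := by
  rw [fibre_vector_eq, wirtBar_add_left, wirtBar_smul_left, wirtBar_smul_left]; rfl

/-- The determinant of the fundamental tensor. -/
def detG (f : ZEta → ℝ) (u : ZEta) : ℂ := g f 0 0 u * g f 1 1 u - g f 0 1 u * g f 1 0 u

/-- The logarithm of the determinant of the fundamental tensor. -/
def logDet (f : ZEta → ℝ) (u : ZEta) : ℂ := Complex.log (detG f u)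

theorem det_gMat (f : ZEta → ℝ) (u : ZEta) : (gMat f u).det = detG f u := by
  rw [Matrix.det_fin_two]; rfl

namespace IsLocalFinsler

variable {f : ZEta → ℝ} {U : Set ZEta} (hf : IsLocalFinsler f U)

section Basic

include hf

theorem contDiffOn_lagr : ContDiffOn ℝ ∞ (lagr f) U :=
  Complex.ofRealCLM.contDiff.comp_contDiffOn hf.smooth

theorem contDiffOn_coe : ContDiffOn ℝ ∞ (fun u => (f u : ℂ)) U := by
  refine Complex.ofRealCLM.contDiff.comp_contDiffOn (f := f) ?_
  have := hf.smooth.sqrt fun x hx => (pow_pos (hf.pos x hx) 2).ne'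
  exact this.congr fun x hx => (Real.sqrt_sq (hf.pos x hx).le).symm

theorem contDiffOn_g (i j : Fin 2) : ContDiffOn ℝ ∞ (g f i j) U :=
  (hf.contDiffOn_lagr.detaBar hf.isOpen j).deta hf.isOpen i

theorem contDiffOn_detG : ContDiffOn ℝ ∞ (detG f) U :=
  ((hf.contDiffOn_g 0 0).mul (hf.contDiffOn_g 1 1)).sub
    ((hf.contDiffOn_g 0 1).mul (hf.contDiffOn_g 1 0))

variable {u : ZEta} (hu : u ∈ U)

include hu

theorem coe_ne_zero : (f u : ℂ) ≠ 0 := Complex.ofReal_ne_zero.2 (hf.pos u hu).ne'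

theorem detG_pos : 0 < detG f u := by
  rw [← det_gMat]; exact (hf.posDef u hu).det_pos

theorem detG_ne_zero : detG f u ≠ 0 := (hf.detG_pos hu).ne'

theorem detG_mem_slitPlane : detG f u ∈ Complex.slitPlane :=
  Or.inl (Complex.pos_iff.1 (hf.detG_pos hu)).1

theorem conj_g (i j : Fin 2) : (starRingEnd ℂ) (g f i j u) = g f j i u :=
  (hf.posDef u hu).isHermitian.apply j i

theorem sqrtDet_sq : sqrtDet f u ^ 2 = detG f u := by
  have h := Complex.pos_iff.1 (hf.detG_pos hu)
  rw [sqrtDet, det_gMat, ← Complex.ofReal_pow, Real.sq_sqrt h.1.le]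
  exact Complex.ext (by simp) (by simpa using h.2)

theorem sqrtDet_ne_zero : sqrtDet f u ≠ 0 := by
  intro h
  apply hf.detG_ne_zero hu
  rw [← hf.sqrtDet_sq hu, h]; simp

theorem differentiableAt_coe : DifferentiableAt ℝ (fun u => (f u : ℂ)) u :=
  hf.contDiffOn_coe.differentiableAt_of_mem hf.isOpen hu

theorem differentiableAt_g (i j : Fin 2) : DifferentiableAt ℝ (g f i j) u :=
  (hf.contDiffOn_g i j).differentiableAt_of_mem hf.isOpen hu

omit hu

theorem contDiffOn_sqrtDet : ContDiffOn ℝ ∞ (sqrtDet f) U := by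
  refine Complex.ofRealCLM.contDiff.comp_contDiffOn
    (f := fun u => Real.sqrt (gMat f u).det.re) ?_
  simp only [det_gMat]
  exact (Complex.reCLM.contDiff.comp_contDiffOn hf.contDiffOn_detG).sqrt
    fun x hx => (Complex.pos_iff.1 (hf.detG_pos hx)).1.ne'

theorem contDiffOn_logDet : ContDiffOn ℝ ∞ (logDet f) U := fun x hx =>
  ((Complex.contDiffAt_log (n := ∞) (hf.detG_mem_slitPlane hx)).restrict_scalars ℝ).comp_contDiffWithinAt x
    (hf.contDiffOn_detG x hx)

include hu

/-! The inverse metric. -/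

theorem gInv_mul_g (w : Fin 2 → ℂ) (m : Fin 2) :
    (∑ l, gInv f l 0 u * w l) * g f 0 m u + (∑ l, gInv f l 1 u * w l) * g f 1 m u = w m := by
  have h1 : (gMat f u)⁻¹ * gMat f u = 1 :=
    Matrix.nonsing_inv_mul _ (by rw [det_gMat]; exact (hf.detG_ne_zero hu).isUnit)
  have h2 := fun l => congrFun (congrFun h1 l) m
  simp only [Matrix.mul_apply, Fin.sum_univ_two, Fin.forall_fin_two, Matrix.one_apply] at h2
  change gInv f 0 0 u * g f 0 m u + gInv f 0 1 u * g f 1 m u = _ ∧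
    gInv f 1 0 u * g f 0 m u + gInv f 1 1 u * g f 1 m u = _ at h2
  simp only [Fin.sum_univ_two]
  obtain ⟨h3, h4⟩ := h2
  fin_cases m <;> simp at h3 h4 ⊢ <;> linear_combination w 0 * h3 + w 1 * h4

theorem eq_of_mul_g_eq {x y : Fin 2 → ℂ}
    (h : ∀ m, x 0 * g f 0 m u + x 1 * g f 1 m u = y 0 * g f 0 m u + y 1 * g f 1 m u) :
    x = y := by
  have h0 := h 0
  have h1 := h 1
  have hd := hf.detG_ne_zero hu
  have e0 : (x 0 - y 0) * detG f u = 0 := by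
    unfold detG; linear_combination g f 1 1 u * h0 - g f 1 0 u * h1
  have e1 : (x 1 - y 1) * detG f u = 0 := by
    unfold detG; linear_combination g f 0 0 u * h1 - g f 0 1 u * h0
  ext i
  fin_cases i
  · simpa [hd, sub_eq_zero] using e0
  · simpa [hd, sub_eq_zero] using e1

omit hu

theorem contDiffOn_gInv (m k : Fin 2) : ContDiffOn ℝ ∞ (gInv f m k) U := by
  have hd : ContDiffOn ℝ ∞ (fun u => (detG f u)⁻¹) U :=
    hf.contDiffOn_detG.inv fun x hx => hf.detG_ne_zero hx
  have : ∀ u, gInv f m k u = (detG f u)⁻¹ * (gMat f u).adjugate m k := by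
    intro u
    simp [gInv, Matrix.inv_def, det_gMat]
  refine (hd.mul (g := fun u => (gMat f u).adjugate m k) ?_).congr fun u _ => this u
  simp only [Matrix.adjugate_fin_two]
  fin_cases m <;> fin_cases k <;> simp [gMat]
  · exact hf.contDiffOn_g 1 1
  · exact (hf.contDiffOn_g 0 1).neg
  · exact (hf.contDiffOn_g 1 0).neg
  · exact hf.contDiffOn_g 0 0

theorem contDiffOn_N (k j : Fin 2) : ContDiffOn ℝ ∞ (N f k j) U := by
  unfold N
  exact ContDiffOn.sum fun m _ => ContDiffOn.sum fun l _ =>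
    ((hf.contDiffOn_gInv m j).mul ((hf.contDiffOn_g l m).dz hf.isOpen k)).mul
      (contDiff_coord l).contDiffOn

theorem contDiffOn_delta {h : ZEta → ℂ} (hh : ContDiffOn ℝ ∞ h U) (k : Fin 2) :
    ContDiffOn ℝ ∞ (delta f k h) U := by
  unfold delta
  exact (hh.dz hf.isOpen k).sub (ContDiffOn.sum fun j _ =>
    (hf.contDiffOn_N k j).mul (hh.deta hf.isOpen j))

/-! Euler identities. -/

include hu

theorem fderiv_lagr_fibre (c : ℂ) :
    fderiv ℝ (lagr f) u (0, c • u.2) = (c + (starRingEnd ℂ) c) * lagr f u := by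
  have h1 : HasDerivAt (fun t : ℝ => lagr f (u + t • (0, c • u.2)))
      (fderiv ℝ (lagr f) u (0, c • u.2)) 0 := by
    have hd := (hf.contDiffOn_lagr.differentiableAt_of_mem hf.isOpen hu).hasFDerivAt
    have hl : HasDerivAt (fun t : ℝ => u + t • ((0, c • u.2) : ZEta)) (0, c • u.2) 0 := by
      simpa using ((hasDerivAt_id (0 : ℝ)).smul_const ((0, c • u.2) : ZEta)).const_add u
    exact HasFDerivAt.comp_hasDerivAt (0 : ℝ) (by simpa using hd) hl
  have h2 : (fun t : ℝ => lagr f (u + t • (0, c • u.2)))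
      = fun t : ℝ => (1 + t * c) * (1 + t * (starRingEnd ℂ) c) * lagr f u := by
    funext t
    have : u + t • ((0, c • u.2) : ZEta) = (u.1, (1 + t * c) • u.2) := by
      ext i
      · simp
      · simp; ring
    have hn : (1 + t * c) * (1 + t * (starRingEnd ℂ) c) = ((‖1 + t * c‖ ^ 2 : ℝ) : ℂ) := by
      rw [Complex.ofReal_pow, ← Complex.mul_conj']; simp
    rw [this, lagr, hf.homogeneous u hu, hn, lagr]
    push_cast; ring
  rw [h2] at h1
  have hl : ∀ a : ℂ, HasDerivAt (fun t : ℝ => 1 + (t : ℂ) * a) a 0 := fun a => by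
    simpa using ((Complex.ofRealCLM.hasDerivAt (x := 0)).mul_const a).const_add 1
  have h3 := ((hl c).mul (hl ((starRingEnd ℂ) c))).mul_const (lagr f u)
  have := h1.unique h3
  rw [this]; simp

theorem euler : u.2 0 * deta 0 (lagr f) u + u.2 1 * deta 1 (lagr f) u = lagr f u := by
  have h1 := hf.fderiv_lagr_fibre hu 1
  have h2 := hf.fderiv_lagr_fibre hu Complex.I
  rw [← wirt_fibre, wirt]
  simp only [one_smul] at h1
  simp only [Prod.smul_mk, smul_zero, h1, h2]
  simp; ring

theorem euler_conj : (starRingEnd ℂ) (u.2 0) * detaBar 0 (lagr f) u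
    + (starRingEnd ℂ) (u.2 1) * detaBar 1 (lagr f) u = lagr f u := by
  have h1 := hf.fderiv_lagr_fibre hu 1
  have h2 := hf.fderiv_lagr_fibre hu Complex.I
  rw [← wirtBar_fibre, wirtBar]
  simp only [one_smul] at h1
  simp only [Prod.smul_mk, smul_zero, h1, h2]
  simp; ring

omit hu in
theorem contDiffOn_deta_lagr (i : Fin 2) : ContDiffOn ℝ ∞ (deta i (lagr f)) U :=
  hf.contDiffOn_lagr.deta hf.isOpen i

omit hu in
theorem contDiffOn_detaBar_lagr (i : Fin 2) : ContDiffOn ℝ ∞ (detaBar i (lagr f)) U :=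
  hf.contDiffOn_lagr.detaBar hf.isOpen i

theorem differentiableAt_deta_lagr (i : Fin 2) : DifferentiableAt ℝ (deta i (lagr f)) u :=
  (hf.contDiffOn_deta_lagr i).differentiableAt_of_mem hf.isOpen hu

theorem differentiableAt_detaBar_lagr (i : Fin 2) : DifferentiableAt ℝ (detaBar i (lagr f)) u :=
  (hf.contDiffOn_detaBar_lagr i).differentiableAt_of_mem hf.isOpen hu

theorem hessian_eta (k : Fin 2) : u.2 0 * deta k (deta 0 (lagr f)) u
    + u.2 1 * deta k (deta 1 (lagr f)) u = 0 := by
  have h := (isDerivationAt_deta k u).congr_of_mem hf.isOpen hu fun x hx => hf.euler hx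
  rw [(isDerivationAt_deta k u).mul_add_mul (differentiableAt_coord 0 u)
    (hf.differentiableAt_deta_lagr hu 0) (differentiableAt_coord 1 u)
    (hf.differentiableAt_deta_lagr hu 1), deta_coord, deta_coord] at h
  fin_cases k <;> simp at h ⊢ <;> linear_combination h

theorem hessian_comm (j k : Fin 2) :
    deta j (deta k (lagr f)) u = deta k (deta j (lagr f)) u :=
  wirt_wirt_comm hf.contDiffOn_lagr hf.isOpen hu _ _

theorem g_conj_eta (k : Fin 2) : (starRingEnd ℂ) (u.2 0) * g f k 0 u
    + (starRingEnd ℂ) (u.2 1) * g f k 1 u = deta k (lagr f) u := by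
  have h := (isDerivationAt_deta k u).congr_of_mem hf.isOpen hu fun x hx => hf.euler_conj hx
  rw [(isDerivationAt_deta k u).mul_add_mul (differentiableAt_conj_coord 0 u)
    (hf.differentiableAt_detaBar_lagr hu 0) (differentiableAt_conj_coord 1 u)
    (hf.differentiableAt_detaBar_lagr hu 1), deta_conj_coord, deta_conj_coord] at h
  rw [← h, g, g]; ring

theorem eta_g (l : Fin 2) : u.2 0 * g f 0 l u + u.2 1 * g f 1 l u = detaBar l (lagr f) u := by
  have h := (isDerivationAt_detaBar l u).congr_of_mem hf.isOpen hu fun x hx => hf.euler hx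
  rw [(isDerivationAt_detaBar l u).mul_add_mul (differentiableAt_coord 0 u)
    (hf.differentiableAt_deta_lagr hu 0) (differentiableAt_coord 1 u)
    (hf.differentiableAt_deta_lagr hu 1), detaBar_coord, detaBar_coord] at h
  have e : ∀ i, detaBar l (deta i (lagr f)) u = g f i l u := fun i =>
    (wirt_wirtBar_comm hf.contDiffOn_lagr hf.isOpen hu _ _).symm
  rw [e, e] at h
  rw [← h]; ring

theorem deta_g_comm (j i l : Fin 2) : deta j (g f i l) u = deta i (g f j l) u :=
  wirt_wirt_comm (hf.contDiffOn_detaBar_lagr l) hf.isOpen hu _ _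

theorem eta_deta_g (j l : Fin 2) : u.2 0 * deta j (g f 0 l) u + u.2 1 * deta j (g f 1 l) u = 0 := by
  have h := (isDerivationAt_deta j u).congr_of_mem hf.isOpen hu fun x hx => hf.eta_g hx l
  rw [(isDerivationAt_deta j u).mul_add_mul (differentiableAt_coord 0 u)
    (hf.differentiableAt_g hu 0 l) (differentiableAt_coord 1 u)
    (hf.differentiableAt_g hu 1 l), deta_coord, deta_coord] at h
  change _ = g f j l u at h
  fin_cases j <;> simp at h ⊢ <;> linear_combination h

theorem conj_eta_deta_g (j k : Fin 2) : (starRingEnd ℂ) (u.2 0) * deta j (g f k 0) u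
    + (starRingEnd ℂ) (u.2 1) * deta j (g f k 1) u = deta j (deta k (lagr f)) u := by
  have h := (isDerivationAt_deta j u).congr_of_mem hf.isOpen hu fun x hx => hf.g_conj_eta hx k
  rw [(isDerivationAt_deta j u).mul_add_mul (differentiableAt_conj_coord 0 u)
    (hf.differentiableAt_g hu k 0) (differentiableAt_conj_coord 1 u)
    (hf.differentiableAt_g hu k 1), deta_conj_coord, deta_conj_coord] at h
  rw [← h]; ring

theorem eta_dz_g (k l : Fin 2) : u.2 0 * dz k (g f 0 l) u + u.2 1 * dz k (g f 1 l) u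
    = dz k (detaBar l (lagr f)) u := by
  have h := (isDerivationAt_dz k u).congr_of_mem hf.isOpen hu fun x hx => hf.eta_g hx l
  rw [(isDerivationAt_dz k u).mul_add_mul (differentiableAt_coord 0 u)
    (hf.differentiableAt_g hu 0 l) (differentiableAt_coord 1 u)
    (hf.differentiableAt_g hu 1 l), dz_coord, dz_coord] at h
  rw [← h]; ring

theorem conj_eta_dz (k : Fin 2) : (starRingEnd ℂ) (u.2 0) * dz k (detaBar 0 (lagr f)) u
    + (starRingEnd ℂ) (u.2 1) * dz k (detaBar 1 (lagr f)) u = dz k (lagr f) u := by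
  have h := (isDerivationAt_dz k u).congr_of_mem hf.isOpen hu fun x hx => hf.euler_conj hx
  rw [(isDerivationAt_dz k u).mul_add_mul (differentiableAt_conj_coord 0 u)
    (hf.differentiableAt_detaBar_lagr hu 0) (differentiableAt_conj_coord 1 u)
    (hf.differentiableAt_detaBar_lagr hu 1), dz_conj_coord, dz_conj_coord] at h
  rw [← h]; ring

/-! The Chern-Finsler connection. -/

theorem N_mul_g (k m : Fin 2) : N f k 0 u * g f 0 m u + N f k 1 u * g f 1 m u
    = dz k (detaBar m (lagr f)) u := by
  have h := hf.gInv_mul_g hu (fun m => ∑ l, dz k (g f l m) u * u.2 l) m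
  simp only [Finset.mul_sum, ← mul_assoc] at h
  rw [← hf.eta_dz_g hu, N, N, h, Fin.sum_univ_two]; ring

theorem Lcoef_mul_g (j k m : Fin 2) : Lcoef f 0 j k u * g f 0 m u + Lcoef f 1 j k u * g f 1 m u
    = delta f k (g f j m) u :=
  hf.gInv_mul_g hu (fun l => delta f k (g f j l) u) m

theorem Ccoef_mul_g (j k m : Fin 2) : Ccoef f 0 j k u * g f 0 m u + Ccoef f 1 j k u * g f 1 m u
    = deta k (g f j m) u :=
  hf.gInv_mul_g hu (fun l => deta k (g f j l) u) m

theorem delta_lagr (k : Fin 2) : delta f k (lagr f) u = 0 := by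
  rw [delta_eq, ← hf.conj_eta_dz hu, ← hf.g_conj_eta hu, ← hf.g_conj_eta hu, ← hf.N_mul_g hu,
    ← hf.N_mul_g hu]
  ring

theorem deta_N (s k j : Fin 2) : deta s (N f k j) u = Lcoef f j s k u := by
  have dN := fun j => (hf.contDiffOn_N k j).differentiableAt_of_mem hf.isOpen hu
  refine congrFun (hf.eq_of_mul_g_eq hu (x := fun j => deta s (N f k j) u)
    (y := fun j => Lcoef f j s k u) fun m => ?_) j
  have h := (isDerivationAt_deta s u).congr_of_mem hf.isOpen hu fun x hx => hf.N_mul_g hx k m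
  rw [(isDerivationAt_deta s u).mul_add_mul (dN 0) (hf.differentiableAt_g hu 0 m) (dN 1)
    (hf.differentiableAt_g hu 1 m)] at h
  have e : deta s (dz k (detaBar m (lagr f))) u = dz k (g f s m) u :=
    wirt_wirt_comm (hf.contDiffOn_detaBar_lagr m) hf.isOpen hu _ _
  rw [e, hf.deta_g_comm hu s 0, hf.deta_g_comm hu s 1] at h
  simp only [hf.Lcoef_mul_g hu, delta_eq]
  linear_combination h

theorem delta_deta {h : ZEta → ℂ} (hh : ContDiffOn ℝ ∞ h U) (k s : Fin 2) :
    delta f k (deta s h) u = deta s (delta f k h) u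
      + (Lcoef f 0 s k u * deta 0 h u + Lcoef f 1 s k u * deta 1 h u) := by
  have dN := fun j => (hf.contDiffOn_N k j).differentiableAt_of_mem hf.isOpen hu
  have dh := fun j => (hh.deta hf.isOpen j).differentiableAt_of_mem hf.isOpen hu
  have dzh := (hh.dz hf.isOpen k).differentiableAt_of_mem hf.isOpen hu
  have e := isDerivationAt_deta s u
  rw [show delta f k h = _ from funext (delta_eq f k h),
    e.sub dzh (((dN 0).fun_mul (dh 0)).fun_add ((dN 1).fun_mul (dh 1))),
    e.mul_add_mul (dN 0) (dh 0) (dN 1) (dh 1), hf.deta_N hu, hf.deta_N hu, delta_eq]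
  have c1 : deta s (dz k h) u = dz k (deta s h) u := wirt_wirt_comm hh hf.isOpen hu _ _
  have c2 : ∀ j, deta s (deta j h) u = deta j (deta s h) u := fun j =>
    wirt_wirt_comm hh hf.isOpen hu _ _
  rw [c1, c2, c2]; ring

end Basic

end IsLocalFinsler

end ComplexFinsler

end

namespace ComplexFinsler

open Filter Topology

namespace IsLocalFinsler

variable {f : ZEta → ℝ} {U : Set ZEta} (hf : IsLocalFinsler f U)

/-! ### The local complex Berwald frame -/

include hf

section Frame

variable {u : ZEta} (hu : u ∈ U)

include hu

theorem lDn_eq (i : Fin 2) : lDn f i u = deta i (lagr f) u / f u := by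
  rw [lDn, Fin.sum_univ_two, ← hf.g_conj_eta hu]; ring

theorem mUp_zero : mUp f 0 u = -deta 1 (lagr f) u / (f u * sqrtDet f u) := by
  simp [mUp, hf.lDn_eq hu]; field_simp

theorem mUp_one : mUp f 1 u = deta 0 (lagr f) u / (f u * sqrtDet f u) := by
  simp [mUp, hf.lDn_eq hu]; field_simp

theorem conj_deta_lagr (i : Fin 2) :
    (starRingEnd ℂ) (deta i (lagr f) u) = detaBar i (lagr f) u := by
  rw [← hf.g_conj_eta hu, ← hf.eta_g hu]
  simp [hf.conj_g hu]

omit hf hu in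
theorem conj_sqrtDet : (starRingEnd ℂ) (sqrtDet f u) = sqrtDet f u := Complex.conj_ofReal _

theorem mDn_zero : mDn f 0 u = -(sqrtDet f u * u.2 1) / f u := by
  have h0 := hf.coe_ne_zero hu
  have h1 := hf.sqrtDet_ne_zero hu
  have h2 := hf.sqrtDet_sq hu
  rw [mDn, Fin.sum_univ_two, hf.mUp_zero hu, hf.mUp_one hu]
  simp only [map_div₀, map_neg, map_mul, Complex.conj_ofReal, conj_sqrtDet,
    hf.conj_deta_lagr hu, ← hf.eta_g hu]
  field_simp
  rw [h2, detG]; ring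

theorem mDn_one : mDn f 1 u = sqrtDet f u * u.2 0 / f u := by
  have h0 := hf.coe_ne_zero hu
  have h1 := hf.sqrtDet_ne_zero hu
  have h2 := hf.sqrtDet_sq hu
  rw [mDn, Fin.sum_univ_two, hf.mUp_zero hu, hf.mUp_one hu]
  simp only [map_div₀, map_neg, map_mul, Complex.conj_ofReal, conj_sqrtDet,
    hf.conj_deta_lagr hu, ← hf.eta_g hu]
  field_simp
  rw [h2, detG]; ring

omit hf hu in
theorem lagr_eq : lagr f u = (f u : ℂ) ^ 2 := by simp [lagr]

theorem frame_completeness (j k : Fin 2) :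
    lUp f j u * lDn f k u + mUp f j u * mDn f k u = if j = k then 1 else 0 := by
  have h0 := hf.coe_ne_zero hu
  have h1 := hf.sqrtDet_ne_zero hu
  have h2 := hf.euler hu
  rw [lagr_eq] at h2
  fin_cases j <;> fin_cases k <;>
    simp [lUp, hf.lDn_eq hu, hf.mUp_zero hu, hf.mUp_one hu, hf.mDn_zero hu, hf.mDn_one hu] <;>
    field_simp <;> first | linear_combination h2 | ring

theorem lUp_mul_lDn : lUp f 0 u * lDn f 0 u + lUp f 1 u * lDn f 1 u = 1 := by
  have h0 := hf.coe_ne_zero hu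
  have h2 := hf.euler hu
  rw [lagr_eq] at h2
  simp only [lUp, hf.lDn_eq hu]
  field_simp
  exact h2

theorem mUp_mul_lDn : mUp f 0 u * lDn f 0 u + mUp f 1 u * lDn f 1 u = 0 := by
  simp only [hf.mUp_zero hu, hf.mUp_one hu, hf.lDn_eq hu]; ring

theorem lUp_mul_mDn : lUp f 0 u * mDn f 0 u + lUp f 1 u * mDn f 1 u = 0 := by
  simp only [hf.mDn_zero hu, hf.mDn_one hu, lUp]; ring

theorem mUp_mul_mDn : mUp f 0 u * mDn f 0 u + mUp f 1 u * mDn f 1 u = 1 := by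
  have h0 := hf.frame_completeness hu 0 0
  have h1 := hf.frame_completeness hu 1 1
  simp at h0 h1
  linear_combination h0 + h1 - hf.lUp_mul_lDn hu

/-- Expansion of a covector in the Berwald coframe. -/
theorem covector_eq (w : Fin 2 → ℂ) (k : Fin 2) :
    w k = (lUp f 0 u * w 0 + lUp f 1 u * w 1) * lDn f k u
      + (mUp f 0 u * w 0 + mUp f 1 u * w 1) * mDn f k u := by
  have h0 := hf.frame_completeness hu 0 k
  have h1 := hf.frame_completeness hu 1 k
  fin_cases k <;> simp at h0 h1 ⊢ <;> linear_combination -w 0 * h0 - w 1 * h1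

omit hu

theorem contDiffOn_lUp (i : Fin 2) : ContDiffOn ℝ ∞ (lUp f i) U := by
  simp only [funext fun u => show lUp f i u = u.2 i * (f u : ℂ)⁻¹ from div_eq_mul_inv _ _]
  exact (contDiff_coord i).contDiffOn.mul
    (hf.contDiffOn_coe.inv fun x hx => hf.coe_ne_zero hx)

theorem contDiffOn_lDn (i : Fin 2) : ContDiffOn ℝ ∞ (lDn f i) U :=
  ((hf.contDiffOn_deta_lagr i).mul
    (hf.contDiffOn_coe.inv fun x hx => hf.coe_ne_zero hx)).congr fun x hx => by
      rw [hf.lDn_eq hx, div_eq_mul_inv]; rfl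

theorem contDiffOn_mUp (i : Fin 2) : ContDiffOn ℝ ∞ (mUp f i) U := by
  have h := hf.contDiffOn_sqrtDet.inv fun x hx => hf.sqrtDet_ne_zero hx
  unfold mUp
  simp only [div_eq_mul_inv]
  fin_cases i
  · exact (hf.contDiffOn_lDn 1).neg.mul h
  · exact (hf.contDiffOn_lDn 0).mul h

theorem contDiffOn_mDn (i : Fin 2) : ContDiffOn ℝ ∞ (mDn f i) U := by
  unfold mDn
  exact ContDiffOn.sum fun j _ => (hf.contDiffOn_g i j).mul
    ((Complex.conjCLE : ℂ →L[ℝ] ℂ).contDiff.comp_contDiffOn (hf.contDiffOn_mUp j))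

include hu

/-! The scalars in terms of `L` and of `log det g`. -/

theorem derivation_detG {X : (ZEta → ℂ) → ℂ} (hX : IsDerivationAt u X) :
    X (detG f) = X (g f 0 0) * g f 1 1 u + g f 0 0 u * X (g f 1 1)
      - (X (g f 0 1) * g f 1 0 u + g f 0 1 u * X (g f 1 0)) := by
  have d := hf.differentiableAt_g hu
  rw [show detG f = fun x => g f 0 0 x * g f 1 1 x - g f 0 1 x * g f 1 0 x from rfl,
    hX.sub ((d _ _).fun_mul (d _ _)) ((d _ _).fun_mul (d _ _)), hX.mul (d _ _) (d _ _),
    hX.mul (d _ _) (d _ _)]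

theorem deta_logDet (k : Fin 2) : deta k (logDet f) u = deta k (detG f) u / detG f u :=
  wirt_log _ (hf.contDiffOn_detG.differentiableAt_of_mem hf.isOpen hu) (hf.detG_mem_slitPlane hu)

theorem delta_logDet (k : Fin 2) : delta f k (logDet f) u = delta f k (detG f) u / detG f u := by
  have : dz k (logDet f) u = dz k (detG f) u / detG f u :=
    wirt_log _ (hf.contDiffOn_detG.differentiableAt_of_mem hf.isOpen hu) (hf.detG_mem_slitPlane hu)
  rw [delta_eq, delta_eq, this, hf.deta_logDet hu, hf.deta_logDet hu]; ring

theorem trace_Lcoef (k : Fin 2) : Lcoef f 0 0 k u + Lcoef f 1 1 k u = delta f k (logDet f) u := by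
  rw [hf.delta_logDet hu, eq_div_iff (hf.detG_ne_zero hu),
    hf.derivation_detG hu (isDerivationAt_delta f k u)]
  simp only [← hf.Lcoef_mul_g hu]
  rw [detG]; ring

theorem trace_Ccoef (k : Fin 2) : Ccoef f 0 0 k u + Ccoef f 1 1 k u = deta k (logDet f) u := by
  rw [hf.deta_logDet hu, eq_div_iff (hf.detG_ne_zero hu),
    hf.derivation_detG hu (isDerivationAt_deta k u)]
  simp only [← hf.Ccoef_mul_g hu]
  rw [detG]; ring

theorem lUp_mul_Ccoef (i k : Fin 2) :
    lUp f 0 u * Ccoef f i 0 k u + lUp f 1 u * Ccoef f i 1 k u = 0 := by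
  refine congrFun (hf.eq_of_mul_g_eq hu (x := fun i => lUp f 0 u * Ccoef f i 0 k u
    + lUp f 1 u * Ccoef f i 1 k u) (y := 0) fun m => ?_) i
  simp only [lUp, Pi.zero_apply]
  linear_combination u.2 0 / f u * hf.Ccoef_mul_g hu 0 k m
    + u.2 1 / f u * hf.Ccoef_mul_g hu 1 k m + 1 / f u * hf.eta_deta_g hu k m

theorem lDn_mul_Ccoef (j k : Fin 2) :
    lDn f 0 u * Ccoef f 0 j k u + lDn f 1 u * Ccoef f 1 j k u
      = deta k (deta j (lagr f)) u / f u := by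
  rw [hf.lDn_eq hu, hf.lDn_eq hu, ← hf.conj_eta_deta_g hu, ← hf.Ccoef_mul_g hu,
    ← hf.Ccoef_mul_g hu, ← hf.g_conj_eta hu, ← hf.g_conj_eta hu]
  ring

theorem JY_eq : JY f u = lUp f 0 u * delta f 0 (logDet f) u
    + lUp f 1 u * delta f 1 (logDet f) u := by
  have h00 := hf.frame_completeness hu 0 0
  have h01 := hf.frame_completeness hu 0 1
  have h10 := hf.frame_completeness hu 1 0
  have h11 := hf.frame_completeness hu 1 1
  simp at h00 h01 h10 h11
  simp only [JY, J, Y, Fin.sum_univ_two, ← hf.trace_Lcoef hu]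
  linear_combination (lUp f 0 u * Lcoef f 0 0 0 u + lUp f 1 u * Lcoef f 0 0 1 u) * h00
    + (lUp f 0 u * Lcoef f 1 0 0 u + lUp f 1 u * Lcoef f 1 0 1 u) * h01
    + (lUp f 0 u * Lcoef f 0 1 0 u + lUp f 1 u * Lcoef f 0 1 1 u) * h10
    + (lUp f 0 u * Lcoef f 1 1 0 u + lUp f 1 u * Lcoef f 1 1 1 u) * h11

theorem VH_eq : VH f u = mUp f 0 u * delta f 0 (logDet f) u
    + mUp f 1 u * delta f 1 (logDet f) u := by
  have h00 := hf.frame_completeness hu 0 0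
  have h01 := hf.frame_completeness hu 0 1
  have h10 := hf.frame_completeness hu 1 0
  have h11 := hf.frame_completeness hu 1 1
  simp at h00 h01 h10 h11
  simp only [VH, V, H, Fin.sum_univ_two, ← hf.trace_Lcoef hu]
  linear_combination (mUp f 0 u * Lcoef f 0 0 0 u + mUp f 1 u * Lcoef f 0 0 1 u) * h00
    + (mUp f 0 u * Lcoef f 1 0 0 u + mUp f 1 u * Lcoef f 1 0 1 u) * h01
    + (mUp f 0 u * Lcoef f 0 1 0 u + mUp f 1 u * Lcoef f 0 1 1 u) * h10
    + (mUp f 0 u * Lcoef f 1 1 0 u + mUp f 1 u * Lcoef f 1 1 1 u) * h11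

theorem B_eq : B f u = mUp f 0 u * deta 0 (logDet f) u + mUp f 1 u * deta 1 (logDet f) u := by
  have h00 := hf.frame_completeness hu 0 0
  have h01 := hf.frame_completeness hu 0 1
  have h10 := hf.frame_completeness hu 1 0
  have h11 := hf.frame_completeness hu 1 1
  simp at h00 h01 h10 h11
  have c := hf.lUp_mul_Ccoef hu
  simp only [B, Fin.sum_univ_two, ← hf.trace_Ccoef hu]
  linear_combination (mUp f 0 u * Ccoef f 0 0 0 u + mUp f 1 u * Ccoef f 0 0 1 u) * h00
    + (mUp f 0 u * Ccoef f 1 0 0 u + mUp f 1 u * Ccoef f 1 0 1 u) * h01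
    + (mUp f 0 u * Ccoef f 0 1 0 u + mUp f 1 u * Ccoef f 0 1 1 u) * h10
    + (mUp f 0 u * Ccoef f 1 1 0 u + mUp f 1 u * Ccoef f 1 1 1 u) * h11
    - lDn f 0 u * (mUp f 0 u * c 0 0 + mUp f 1 u * c 0 1)
    - lDn f 1 u * (mUp f 0 u * c 1 0 + mUp f 1 u * c 1 1)

theorem A_mul_eq : f u * A f u =
    mUp f 0 u * vertM f (deta 0 (lagr f)) u + mUp f 1 u * vertM f (deta 1 (lagr f)) u := by
  have h0 := hf.coe_ne_zero hu
  have c := fun j k => (div_eq_iff h0).1 (hf.lDn_mul_Ccoef hu j k).symm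
  simp only [vertM_eq, A, Fin.sum_univ_two, c]
  ring

theorem lUp_vertM_deta_lagr :
    lUp f 0 u * vertM f (deta 0 (lagr f)) u + lUp f 1 u * vertM f (deta 1 (lagr f)) u = 0 := by
  simp only [vertM_eq, lUp]
  linear_combination mUp f 0 u / f u * hf.hessian_eta hu 0 + mUp f 1 u / f u * hf.hessian_eta hu 1

/-! Derivatives of the frame. -/

theorem derivation_coe {X : (ZEta → ℂ) → ℂ} (hX : IsDerivationAt u X) :
    X (fun x => (f x : ℂ)) = X (lagr f) / (2 * f u) :=
  hX.of_sq_eq (hf.differentiableAt_coe hu) (hf.coe_ne_zero hu)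
    (Eventually.of_forall fun x => by simp [lagr])

theorem derivation_sqrtDet {X : (ZEta → ℂ) → ℂ} (hX : IsDerivationAt u X) :
    X (sqrtDet f) = X (detG f) / (2 * sqrtDet f u) :=
  hX.of_sq_eq (hf.contDiffOn_sqrtDet.differentiableAt_of_mem hf.isOpen hu)
    (hf.sqrtDet_ne_zero hu)
    (by filter_upwards [hf.isOpen.mem_nhds hu] with x hx using hf.sqrtDet_sq hx)

theorem derivation_mUp {X : (ZEta → ℂ) → ℂ} (hX : IsDerivationAt u X) (i j : Fin 2) (c : ℂ)
    (h : ∀ x ∈ U, mUp f i x = c * (deta j (lagr f) x / (f x * sqrtDet f x))) :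
    X (mUp f i) = c * X (deta j (lagr f)) / (f u * sqrtDet f u)
      - mUp f i u * (X (lagr f) / (2 * f u ^ 2) + X (detG f) / (2 * detG f u)) := by
  have h0 := hf.coe_ne_zero hu
  have h1 := hf.sqrtDet_ne_zero hu
  have d1 := hf.differentiableAt_coe hu
  have d2 := hf.contDiffOn_sqrtDet.differentiableAt_of_mem hf.isOpen hu
  have d3 := hf.differentiableAt_deta_lagr hu j
  have hn := mul_ne_zero h0 h1
  have d4 : DifferentiableAt ℝ
      (fun x => deta j (lagr f) x / ((f x : ℂ) * sqrtDet f x)) u := by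
    simp only [div_eq_mul_inv]
    exact d3.fun_mul ((d1.fun_mul d2).fun_inv hn)
  rw [hX.congr_of_mem hf.isOpen hu h, hX.const_mul _ d4, hX.div d3 (d1.fun_mul d2) hn,
    hX.mul d1 d2, hf.derivation_coe hu hX, hf.derivation_sqrtDet hu hX, h u hu,
    ← hf.sqrtDet_sq hu]
  field_simp

theorem derivation_mUp_zero {X : (ZEta → ℂ) → ℂ} (hX : IsDerivationAt u X) :
    X (mUp f 0) = -X (deta 1 (lagr f)) / (f u * sqrtDet f u)
      - mUp f 0 u * (X (lagr f) / (2 * f u ^ 2) + X (detG f) / (2 * detG f u)) := by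
  rw [hf.derivation_mUp hu hX 0 1 (-1) fun x hx => by rw [hf.mUp_zero hx]; ring]
  ring

theorem derivation_mUp_one {X : (ZEta → ℂ) → ℂ} (hX : IsDerivationAt u X) :
    X (mUp f 1) = X (deta 0 (lagr f)) / (f u * sqrtDet f u)
      - mUp f 1 u * (X (lagr f) / (2 * f u ^ 2) + X (detG f) / (2 * detG f u)) := by
  rw [hf.derivation_mUp hu hX 1 0 1 fun x hx => by rw [hf.mUp_one hx]; ring]
  ring

theorem derivation_lUp {X : (ZEta → ℂ) → ℂ} (hX : IsDerivationAt u X) (i : Fin 2) :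
    X (lUp f i) = X (fun x => x.2 i) / f u - lUp f i u * (X (lagr f) / (2 * f u ^ 2)) := by
  have h0 := hf.coe_ne_zero hu
  rw [show lUp f i = fun x => x.2 i / (f x : ℂ) from rfl,
    hX.div (differentiableAt_coord i u) (hf.differentiableAt_coe hu) h0,
    hf.derivation_coe hu hX]
  field_simp

theorem derivation_lDn {X : (ZEta → ℂ) → ℂ} (hX : IsDerivationAt u X) (i : Fin 2) :
    X (lDn f i) = X (deta i (lagr f)) / f u - lDn f i u * (X (lagr f) / (2 * f u ^ 2)) := by
  have h0 := hf.coe_ne_zero hu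
  rw [hX.congr_of_mem hf.isOpen hu fun x hx => hf.lDn_eq hx i,
    hX.div (hf.differentiableAt_deta_lagr hu i) (hf.differentiableAt_coe hu) h0,
    hf.derivation_coe hu hX, hf.lDn_eq hu]
  field_simp

theorem derivation_mDn {X : (ZEta → ℂ) → ℂ} (hX : IsDerivationAt u X) (i j : Fin 2) (c : ℂ)
    (h : ∀ x ∈ U, mDn f i x = c * (sqrtDet f x * x.2 j / f x)) :
    X (mDn f i) = c * sqrtDet f u * X (fun x => x.2 j) / f u
      + mDn f i u * (X (detG f) / (2 * detG f u) - X (lagr f) / (2 * f u ^ 2)) := by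
  have h0 := hf.coe_ne_zero hu
  have h1 := hf.sqrtDet_ne_zero hu
  have d1 := hf.differentiableAt_coe hu
  have d2 := hf.contDiffOn_sqrtDet.differentiableAt_of_mem hf.isOpen hu
  have d3 := differentiableAt_coord j u
  have d4 : DifferentiableAt ℝ (fun x => sqrtDet f x * x.2 j / (f x : ℂ)) u := by
    simp only [div_eq_mul_inv]
    exact (d2.fun_mul d3).fun_mul (d1.fun_inv h0)
  rw [hX.congr_of_mem hf.isOpen hu h, hX.const_mul _ d4, hX.div (d2.fun_mul d3) d1 h0,
    hX.mul d2 d3, hf.derivation_coe hu hX, hf.derivation_sqrtDet hu hX, h u hu,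
    ← hf.sqrtDet_sq hu]
  field_simp
  ring

theorem delta_deta_lagr (k i : Fin 2) : delta f k (deta i (lagr f)) u
    = Lcoef f 0 i k u * deta 0 (lagr f) u + Lcoef f 1 i k u * deta 1 (lagr f) u := by
  rw [hf.delta_deta hu hf.contDiffOn_lagr, (isDerivationAt_deta i u).congr_of_mem hf.isOpen hu
    (k := fun _ => 0) fun x hx => hf.delta_lagr hx k, (isDerivationAt_deta i u).const, zero_add]

theorem delta_mUp (k s : Fin 2) : delta f k (mUp f s) u
    = 1 / 2 * delta f k (logDet f) u * mUp f s u
      - (Lcoef f s 0 k u * mUp f 0 u + Lcoef f s 1 k u * mUp f 1 u) := by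
  have h0 := hf.coe_ne_zero hu
  have h1 := hf.sqrtDet_ne_zero hu
  have e := hf.delta_logDet hu k
  have t := hf.trace_Lcoef hu k
  rw [e] at t
  fin_cases s
  · simp only [Fin.zero_eta]
    rw [hf.derivation_mUp_zero hu (isDerivationAt_delta f k u), hf.delta_lagr hu,
      hf.delta_deta_lagr hu, e]
    have : delta f k (detG f) u / (2 * detG f u) = 1 / 2 * (Lcoef f 0 0 k u + Lcoef f 1 1 k u) := by
      rw [t]; ring
    rw [this, ← t, hf.mUp_zero hu, hf.mUp_one hu]
    field_simp
    ring
  · simp only [Fin.mk_one]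
    rw [hf.derivation_mUp_one hu (isDerivationAt_delta f k u), hf.delta_lagr hu,
      hf.delta_deta_lagr hu, e]
    have : delta f k (detG f) u / (2 * detG f u) = 1 / 2 * (Lcoef f 0 0 k u + Lcoef f 1 1 k u) := by
      rw [t]; ring
    rw [this, ← t, hf.mUp_zero hu, hf.mUp_one hu]
    field_simp
    ring

theorem vertM_lagr : vertM f (lagr f) u = 0 := by
  rw [vertM_eq, hf.mUp_zero hu, hf.mUp_one hu]; ring

theorem vertM_lDn (k : Fin 2) : vertM f (lDn f k) u = A f u * mDn f k u := by
  have h0 := hf.coe_ne_zero hu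
  rw [hf.derivation_lDn hu (isDerivationAt_vertM f u), hf.vertM_lagr hu,
    hf.covector_eq hu (fun k => vertM f (deta k (lagr f)) u) k, hf.lUp_vertM_deta_lagr hu,
    ← hf.A_mul_eq hu]
  field_simp
  ring

theorem vertM_detG : vertM f (detG f) u = B f u * detG f u := by
  have := hf.detG_ne_zero hu
  rw [hf.B_eq hu, hf.deta_logDet hu, hf.deta_logDet hu, vertM_eq]
  field_simp

omit hf hu in
theorem vertM_coord (i : Fin 2) : vertM f (fun x => x.2 i) u = mUp f i u := by
  rw [vertM_eq, deta_coord, deta_coord]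
  fin_cases i <;> simp

theorem vertM_mDn (k : Fin 2) :
    vertM f (mDn f k) u = 1 / 2 * B f u * mDn f k u - lDn f k u / f u := by
  have h0 := hf.coe_ne_zero hu
  have h1 := hf.sqrtDet_ne_zero hu
  have h2 := hf.detG_ne_zero hu
  have e : vertM f (detG f) u / (2 * detG f u) = 1 / 2 * B f u := by
    rw [hf.vertM_detG hu]; field_simp
  fin_cases k
  · simp only [Fin.zero_eta]
    rw [hf.derivation_mDn hu (isDerivationAt_vertM f u) 0 1 (-1)
      fun x hx => by rw [hf.mDn_zero hx]; ring]
    rw [e, hf.vertM_lagr hu, vertM_coord, hf.mUp_one hu, hf.lDn_eq hu]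
    field_simp
    ring
  · simp only [Fin.mk_one]
    rw [hf.derivation_mDn hu (isDerivationAt_vertM f u) 1 0 1
      fun x hx => by rw [hf.mDn_one hx]; ring]
    rw [e, hf.vertM_lagr hu, vertM_coord, hf.mUp_zero hu, hf.lDn_eq hu]
    field_simp
    ring

omit hu in
theorem contDiffOn_JY : ContDiffOn ℝ ∞ (JY f) U := by
  refine ContDiffOn.congr ?_ fun x hx => hf.JY_eq hx
  exact ((hf.contDiffOn_lUp 0).mul (hf.contDiffOn_delta hf.contDiffOn_logDet 0)).add
    ((hf.contDiffOn_lUp 1).mul (hf.contDiffOn_delta hf.contDiffOn_logDet 1))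

omit hu in
theorem contDiffOn_VH : ContDiffOn ℝ ∞ (VH f) U := by
  refine ContDiffOn.congr ?_ fun x hx => hf.VH_eq hx
  exact ((hf.contDiffOn_mUp 0).mul (hf.contDiffOn_delta hf.contDiffOn_logDet 0)).add
    ((hf.contDiffOn_mUp 1).mul (hf.contDiffOn_delta hf.contDiffOn_logDet 1))

theorem delta_logDet_eq (k : Fin 2) :
    delta f k (logDet f) u = JY f u * lDn f k u + VH f u * mDn f k u := by
  rw [hf.JY_eq hu, hf.VH_eq hu]
  exact hf.covector_eq hu (fun k => delta f k (logDet f) u) k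

theorem vertM_delta_logDet (k : Fin 2) : vertM f (delta f k (logDet f)) u
    = (vertM f (JY f) u - VH f u / f u) * lDn f k u
      + (1 / 2 * B f u * VH f u + vertM f (VH f) u + A f u * JY f u) * mDn f k u := by
  have dd := fun {h : ZEta → ℂ} (hh : ContDiffOn ℝ ∞ h U) =>
    hh.differentiableAt_of_mem hf.isOpen hu
  rw [(isDerivationAt_vertM f u).congr_of_mem hf.isOpen hu fun x hx => hf.delta_logDet_eq hx k,
    (isDerivationAt_vertM f u).mul_add_mul (dd hf.contDiffOn_JY) (dd (hf.contDiffOn_lDn k))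
      (dd hf.contDiffOn_VH) (dd (hf.contDiffOn_mDn k)), hf.vertM_lDn hu, hf.vertM_mDn hu]
  ring

theorem delta_B_eq_vertM (k : Fin 2) : delta f k (B f) u
    = 1 / 2 * delta f k (logDet f) u * B f u + vertM f (delta f k (logDet f)) u := by
  have dd := fun {h : ZEta → ℂ} (hh : ContDiffOn ℝ ∞ h U) =>
    hh.differentiableAt_of_mem hf.isOpen hu
  rw [(isDerivationAt_delta f k u).congr_of_mem hf.isOpen hu fun x hx => hf.B_eq hx,
    (isDerivationAt_delta f k u).mul_add_mul (dd (hf.contDiffOn_mUp 0))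
      (dd (hf.contDiffOn_logDet.deta hf.isOpen 0)) (dd (hf.contDiffOn_mUp 1))
      (dd (hf.contDiffOn_logDet.deta hf.isOpen 1)), hf.delta_mUp hu, hf.delta_mUp hu,
    hf.delta_deta hu hf.contDiffOn_logDet, hf.delta_deta hu hf.contDiffOn_logDet, vertM_eq,
    hf.B_eq hu]
  ring

/-- The horizontal derivative of `B`. -/
theorem delta_B (k : Fin 2) : delta f k (B f) u
    = (B f u / 2 * JY f u + vertM f (JY f) u - 1 / (f u : ℂ) * VH f u) * lDn f k u
      + (B f u * VH f u + vertM f (VH f) u + A f u * JY f u) * mDn f k u := by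
  rw [hf.delta_B_eq_vertM hu, hf.vertM_delta_logDet hu, hf.delta_logDet_eq hu]
  ring

/-! Homogeneity. -/

theorem vertEta_lagr : vertEta (lagr f) u = lagr f u := by
  rw [vertEta_eq]; exact hf.euler hu

omit hf hu in
theorem vertEta_coord (i : Fin 2) : vertEta (fun x => x.2 i) u = u.2 i := by
  rw [vertEta_eq, deta_coord, deta_coord]
  fin_cases i <;> simp

theorem vertEta_g (i l : Fin 2) : vertEta (g f i l) u = 0 := by
  rw [vertEta_eq, hf.deta_g_comm hu, hf.deta_g_comm hu 1]; exact hf.eta_deta_g hu i l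

theorem vertEta_detG : vertEta (detG f) u = 0 := by
  rw [hf.derivation_detG hu (isDerivationAt_vertEta u)]
  simp only [hf.vertEta_g hu]; ring

theorem vertEta_logDet : vertEta (logDet f) u = 0 := by
  have h := hf.vertEta_detG hu
  rw [vertEta_eq] at h ⊢
  rw [hf.deta_logDet hu, hf.deta_logDet hu]
  linear_combination h / detG f u

theorem vertEta_deta_lagr (i : Fin 2) : vertEta (deta i (lagr f)) u = 0 := by
  rw [vertEta_eq, hf.hessian_comm hu, hf.hessian_comm hu 1]; exact hf.hessian_eta hu i

theorem eta_Lcoef (j k : Fin 2) :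
    u.2 0 * Lcoef f j 0 k u + u.2 1 * Lcoef f j 1 k u = N f k j u := by
  refine congrFun (hf.eq_of_mul_g_eq hu (x := fun j => u.2 0 * Lcoef f j 0 k u
    + u.2 1 * Lcoef f j 1 k u) (y := fun j => N f k j u) fun m => ?_) j
  rw [hf.N_mul_g hu, ← hf.eta_dz_g hu]
  have l0 := hf.Lcoef_mul_g hu 0 k m
  have l1 := hf.Lcoef_mul_g hu 1 k m
  rw [delta_eq] at l0 l1
  linear_combination u.2 0 * l0 + u.2 1 * l1
    - N f k 0 u * hf.eta_deta_g hu 0 m - N f k 1 u * hf.eta_deta_g hu 1 m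

theorem vertEta_delta_logDet (k : Fin 2) : vertEta (delta f k (logDet f)) u = 0 := by
  have dd := fun j => (hf.contDiffOn_logDet.deta hf.isOpen j).differentiableAt_of_mem hf.isOpen hu
  have h := (isDerivationAt_delta f k u).congr_of_mem hf.isOpen hu
    (h := fun x => x.2 0 * deta 0 (logDet f) x + x.2 1 * deta 1 (logDet f) x)
    (k := fun _ => 0) fun x hx => by rw [← vertEta_eq]; exact hf.vertEta_logDet hx
  rw [(isDerivationAt_delta f k u).const, (isDerivationAt_delta f k u).mul_add_mul
    (differentiableAt_coord 0 u) (dd 0) (differentiableAt_coord 1 u) (dd 1), delta_coord,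
    delta_coord, hf.delta_deta hu hf.contDiffOn_logDet, hf.delta_deta hu hf.contDiffOn_logDet] at h
  rw [vertEta_eq]
  linear_combination h - deta 0 (logDet f) u * hf.eta_Lcoef hu 0 k
    - deta 1 (logDet f) u * hf.eta_Lcoef hu 1 k

theorem vertEta_lUp (i : Fin 2) : vertEta (lUp f i) u = lUp f i u / 2 := by
  have h0 := hf.coe_ne_zero hu
  rw [hf.derivation_lUp hu (isDerivationAt_vertEta u), vertEta_coord, hf.vertEta_lagr hu,
    lagr_eq, lUp]
  field_simp
  ring

theorem vertEta_mUp (i : Fin 2) : vertEta (mUp f i) u = -(mUp f i u / 2) := by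
  have h0 := hf.coe_ne_zero hu
  fin_cases i
  · simp only [Fin.zero_eta]
    rw [hf.derivation_mUp_zero hu (isDerivationAt_vertEta u), hf.vertEta_deta_lagr hu,
      hf.vertEta_lagr hu, hf.vertEta_detG hu, lagr_eq]
    field_simp
    ring
  · simp only [Fin.mk_one]
    rw [hf.derivation_mUp_one hu (isDerivationAt_vertEta u), hf.vertEta_deta_lagr hu,
      hf.vertEta_lagr hu, hf.vertEta_detG hu, lagr_eq]
    field_simp
    ring

theorem vertEta_JY : vertEta (JY f) u = JY f u / 2 := by
  have dd := fun {h : ZEta → ℂ} (hh : ContDiffOn ℝ ∞ h U) =>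
    hh.differentiableAt_of_mem hf.isOpen hu
  have ds := hf.contDiffOn_delta hf.contDiffOn_logDet
  rw [(isDerivationAt_vertEta u).congr_of_mem hf.isOpen hu fun x hx => hf.JY_eq hx,
    (isDerivationAt_vertEta u).mul_add_mul (dd (hf.contDiffOn_lUp 0)) (dd (ds 0))
      (dd (hf.contDiffOn_lUp 1)) (dd (ds 1))]
  simp only [hf.vertEta_delta_logDet hu, hf.vertEta_lUp hu, hf.JY_eq hu]
  ring

theorem vertEta_VH : vertEta (VH f) u = -(VH f u / 2) := by
  have dd := fun {h : ZEta → ℂ} (hh : ContDiffOn ℝ ∞ h U) =>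
    hh.differentiableAt_of_mem hf.isOpen hu
  have ds := hf.contDiffOn_delta hf.contDiffOn_logDet
  rw [(isDerivationAt_vertEta u).congr_of_mem hf.isOpen hu fun x hx => hf.VH_eq hx,
    (isDerivationAt_vertEta u).mul_add_mul (dd (hf.contDiffOn_mUp 0)) (dd (ds 0))
      (dd (hf.contDiffOn_mUp 1)) (dd (ds 1))]
  simp only [hf.vertEta_delta_logDet hu, hf.vertEta_mUp hu, hf.VH_eq hu]
  ring

/-! Consequences of the vanishing of `A` or of `B` on an open set. -/

theorem hessian_eq_zero_of_A_eq_zero (hA : A f u = 0) (j k : Fin 2) :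
    deta j (deta k (lagr f)) u = 0 := by
  have hm : ∀ k, vertM f (deta k (lagr f)) u = 0 := fun k => by
    rw [hf.covector_eq hu (fun k => vertM f (deta k (lagr f)) u) k, hf.lUp_vertM_deta_lagr hu,
      ← hf.A_mul_eq hu, hA]
    simp
  rw [hf.covector_eq hu (fun j => deta j (deta k (lagr f)) u) j]
  have h := hf.vertEta_deta_lagr hu k
  have h' := hm k
  rw [vertEta_eq] at h
  rw [vertM_eq] at h'
  simp only [h', lUp]
  linear_combination lDn f j u / f u * h

theorem deta_g_eq_zero (hA : ∀ᶠ x in 𝓝 u, A f x = 0) (i j l : Fin 2) :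
    deta i (g f j l) u = 0 := by
  have e : ∀ᶠ x in 𝓝 u, g f j l x = detaBar l (deta j (lagr f)) x := by
    filter_upwards [hf.isOpen.mem_nhds hu] with x hx
    exact wirt_wirtBar_comm hf.contDiffOn_lagr hf.isOpen hx _ _
  rw [(isDerivationAt_deta i u).congr e]
  change wirt _ (wirtBar _ _) u = 0
  rw [wirt_wirtBar_comm (hf.contDiffOn_deta_lagr j) hf.isOpen hu]
  change wirtBar _ (deta i (deta j (lagr f))) u = 0
  rw [(isDerivationAt_wirtBar _ u).congr (k := fun _ => 0), (isDerivationAt_wirtBar _ u).const]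
  filter_upwards [hf.isOpen.mem_nhds hu, hA] with x hx hAx
  exact hf.hessian_eq_zero_of_A_eq_zero hx hAx i j

theorem B_eq_zero_of_A_eq_zero (hA : ∀ᶠ x in 𝓝 u, A f x = 0) : B f u = 0 := by
  have hC : ∀ i j k, Ccoef f i j k u = 0 := fun i j k => by
    simp [Ccoef, hf.deta_g_eq_zero hu hA]
  simp [B, hC]

theorem fderiv_g_fibre_eq_zero (hA : ∀ᶠ x in 𝓝 u, A f x = 0) (i j : Fin 2) (η : C2) :
    fderiv ℝ (g f i j) u (0, η) = 0 := by
  have hbar : wirtBar (0, η) (g f i j) u = 0 := by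
    have e : ∀ x ∈ U, g f i j x = (starRingEnd ℂ) (g f j i x) := fun x hx =>
      (hf.conj_g hx j i).symm
    rw [(isDerivationAt_wirtBar _ u).congr_of_mem hf.isOpen hu e,
      wirtBar_conj _ (hf.differentiableAt_g hu j i), wirt_fibre]
    simp [hf.deta_g_eq_zero hu hA]
  rw [← wirt_add_wirtBar, hbar, wirt_fibre]
  simp [hf.deta_g_eq_zero hu hA]

theorem vertM_JY_of_B_eq_zero (hB : ∀ᶠ x in 𝓝 u, B f x = 0) :
    vertM f (JY f) u = 1 / (f u : ℂ) * VH f u := by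
  have h : ∀ k, delta f k (B f) u = 0 := fun k => by
    rw [(isDerivationAt_delta f k u).congr (k := fun _ => 0) hB, (isDerivationAt_delta f k u).const]
  simp only [hf.delta_B hu, hB.self_of_nhds] at h
  linear_combination lUp f 0 u * h 0 + lUp f 1 u * h 1
    - (vertM f (JY f) u - 1 / (f u : ℂ) * VH f u) * hf.lUp_mul_lDn hu
    - (vertM f (VH f) u + A f u * JY f u) * hf.lUp_mul_mDn hu

theorem vertM_VH_of_B_eq_zero (hB : ∀ᶠ x in 𝓝 u, B f x = 0) :
    vertM f (VH f) u = -(A f u * JY f u) := by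
  have h : ∀ k, delta f k (B f) u = 0 := fun k => by
    rw [(isDerivationAt_delta f k u).congr (k := fun _ => 0) hB, (isDerivationAt_delta f k u).const]
  simp only [hf.delta_B hu, hB.self_of_nhds] at h
  linear_combination mUp f 0 u * h 0 + mUp f 1 u * h 1
    - (vertM f (JY f) u - 1 / (f u : ℂ) * VH f u) * hf.mUp_mul_lDn hu
    - (vertM f (VH f) u + A f u * JY f u) * hf.mUp_mul_mDn hu

theorem eventually_B_ne_zero (hB : B f u ≠ 0) : ∀ᶠ x in 𝓝 u, B f x ≠ 0 := by
  have h : ContDiffOn ℝ ∞ (B f) U := by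
    refine ContDiffOn.congr ?_ fun x hx => hf.B_eq hx
    exact ((hf.contDiffOn_mUp 0).mul (hf.contDiffOn_logDet.deta hf.isOpen 0)).add
      ((hf.contDiffOn_mUp 1).mul (hf.contDiffOn_logDet.deta hf.isOpen 1))
  exact (h.differentiableAt_of_mem hf.isOpen hu).continuousAt.eventually_ne hB

end Frame

/-- If `A` vanishes on an open set then `g` is constant on its preconnected fibres. -/
theorem g_eq_of_A_eq_zero {W : Set ZEta} (hW : IsOpen W) (hWU : W ⊆ U)
    (hA : ∀ u ∈ W, A f u = 0) {z : C2} (hz : IsPreconnected {η : C2 | (z, η) ∈ W})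
    {η η' : C2} (hη : (z, η) ∈ W) (hη' : (z, η') ∈ W) (i j : Fin 2) :
    g f i j (z, η) = g f i j (z, η') := by
  have hd : ∀ w ∈ {η : C2 | (z, η) ∈ W}, HasFDerivAt (fun w : C2 => g f i j (z, w))
      (0 : C2 →L[ℝ] ℂ) w := by
    intro w hw
    have h1 := (hf.differentiableAt_g (hWU hw) i j).hasFDerivAt.comp w
      (hasFDerivAt_prodMk_right (𝕜 := ℝ) z w)
    refine h1.congr_fderiv (ContinuousLinearMap.ext fun v => ?_)
    have hA' : ∀ᶠ x in 𝓝 ((z, w) : ZEta), A f x = 0 := by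
      filter_upwards [hW.mem_nhds hw] with x hx using hA x hx
    exact hf.fderiv_g_fibre_eq_zero (hWU hw) hA' i j v
  have ho : IsOpen {η : C2 | (z, η) ∈ W} := hW.preimage (Continuous.prodMk_right z)
  exact ho.is_const_of_fderiv_eq_zero (𝕜 := ℝ) hz
    (fun w hw => (hd w hw).differentiableAt.differentiableWithinAt)
    (fun w hw => (hd w hw).fderiv) hη hη'

end IsLocalFinsler

end ComplexFinsler

namespace ComplexFinsler

open Filter Topology

/-! ### Charts -/

section Charts

variable {M : Type*} [TopologicalSpace M] [ChartedSpace C2 M] [IsManifold 𝓘(ℂ, C2) ω M]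
  {e : OpenPartialHomeomorph M C2}

omit [IsManifold 𝓘(ℂ, C2) ω M] in
theorem mdifferentiable_of_mem_charts (he : e ∈ charts M) :
    e.MDifferentiable 𝓘(ℂ, C2) 𝓘(ℂ, C2) :=
  ⟨(contMDiffOn_of_mem_maximalAtlas he).mdifferentiableOn (by simp),
    (contMDiffOn_symm_of_mem_maximalAtlas he).mdifferentiableOn (by simp)⟩

theorem continuousOn_tvec (he : e ∈ charts M) :
    ContinuousOn (tvec e) (e.target ×ˢ Set.univ) := by
  have h1 := (contMDiffOn_symm_of_mem_maximalAtlas he).continuousOn_tangentMapWithin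
    (by simp) e.open_target.uniqueMDiffOn
  have h2 : Continuous fun u : ZEta => (tangentBundleModelSpaceHomeomorph 𝓘(ℂ, C2)).symm u :=
    (tangentBundleModelSpaceHomeomorph 𝓘(ℂ, C2)).symm.continuous
  refine (h1.comp h2.continuousOn fun u hu => hu.1).congr fun u hu => ?_
  have : mfderivWithin 𝓘(ℂ, C2) 𝓘(ℂ, C2) e.symm e.target u.1
      = mfderiv 𝓘(ℂ, C2) 𝓘(ℂ, C2) e.symm u.1 :=
    mfderivWithin_of_isOpen e.open_target hu.1
  change tvec e u = ⟨e.symm u.1, mfderivWithin 𝓘(ℂ, C2) 𝓘(ℂ, C2) e.symm e.target u.1 u.2⟩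
  rw [this, tvec]

theorem isOpen_coordSet (he : e ∈ charts M) {D : Set (TangentBundle 𝓘(ℂ, C2) M)}
    (hD : IsOpen D) : IsOpen (coordSet e D) := by
  have h := (continuousOn_tvec he).isOpen_inter_preimage (e.open_target.prod isOpen_univ) hD
  convert h using 1
  ext u
  simp [coordSet]

omit [IsManifold 𝓘(ℂ, C2) ω M] in
theorem isPreconnected_fibre_coordSet (he : e ∈ charts M) {D : Set (TangentBundle 𝓘(ℂ, C2) M)}
    (hD : ∀ p : M, IsPreconnected {v : TangentSpace 𝓘(ℂ, C2) p |
      (⟨p, v⟩ : TangentBundle 𝓘(ℂ, C2) M) ∈ D}) {z : C2} (hz : z ∈ e.target) :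
    IsPreconnected {η : C2 | (z, η) ∈ coordSet e D} := by
  have hs := (mdifferentiable_of_mem_charts he).symm
  let T := hs.mfderiv (x := z) hz
  have h := (hD (e.symm z)).image T.symm T.symm.continuous.continuousOn
  suffices hs : {η : C2 | (z, η) ∈ coordSet e D} = T.symm '' {v | ⟨e.symm z, v⟩ ∈ D} by
    rw [hs]; exact h
  refine Set.ext fun (η : C2) => ?_
  constructor
  · intro hη
    refine ⟨T η, hη.2, T.symm_apply_apply η⟩
  · rintro ⟨v, hv, rfl⟩
    refine ⟨hz, ?_⟩
    change (⟨e.symm z, T (T.symm v)⟩ : TangentBundle 𝓘(ℂ, C2) M) ∈ D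
    rw [T.apply_symm_apply]
    exact hv

variable {F : TangentBundle 𝓘(ℂ, C2) M → ℝ}

theorem IsComplexFinsler.isLocalFinsler (hF : IsComplexFinsler F) (he : e ∈ charts M) :
    IsLocalFinsler (coordF F e) (e.target ×ˢ {η : C2 | η ≠ 0}) where
  isOpen := e.open_target.prod isOpen_ne
  smooth := hF.smooth e he
  pos u hu := by
    refine lt_of_le_of_ne (hF.nonneg _) fun h => hu.2 ?_
    have h0 := (hF.eq_zero_iff _ _).1 h.symm
    exact (mdifferentiable_of_mem_charts he).symm.mfderiv_injective hu.1 (h0.trans (map_zero _).symm)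
  homogeneous u hu c := by
    have := hF.homogeneous (e.symm u.1) (mfderiv 𝓘(ℂ, C2) 𝓘(ℂ, C2) e.symm u.1 u.2) c
    unfold coordF tvec
    rw [← this]
    exact congrArg (fun v => F ⟨e.symm u.1, v⟩) (map_smul _ c u.2)
  posDef u hu := hF.posDef e he u.1 hu.1 u.2 hu.2

omit [IsManifold 𝓘(ℂ, C2) ω M] in
theorem coordSet_subset {D : Set (TangentBundle 𝓘(ℂ, C2) M)}
    (hD : ∀ v ∈ D, v.2 ≠ 0) : coordSet e D ⊆ e.target ×ˢ {η : C2 | η ≠ 0} := fun u hu =>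
  ⟨hu.1, fun h0 => hD _ hu.2 (by
    change mfderiv 𝓘(ℂ, C2) 𝓘(ℂ, C2) e.symm u.1 u.2 = 0
    rw [h0]; exact map_zero _)⟩

end Charts

end ComplexFinsler

theorem theorem4p2 {M : Type*} [TopologicalSpace M] [ChartedSpace C2 M]
    [IsManifold 𝓘(ℂ, C2) ω M]
    (F : TangentBundle 𝓘(ℂ, C2) M → ℝ) (hF : IsComplexFinsler F)
    (D : Set (TangentBundle 𝓘(ℂ, C2) M)) (hDopen : IsOpen D)
    (hDslit : ∀ v ∈ D, v.2 ≠ 0)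
    (hDfib : ∀ p : M, IsPreconnected {v : TangentSpace 𝓘(ℂ, C2) p |
      (⟨p, v⟩ : TangentBundle 𝓘(ℂ, C2) M) ∈ D}) :
    -- (i)
    IsPurelyHermitianOn F D ∨
    -- (ii)
    ((∃ e ∈ charts M, ∃ u ∈ coordSet e D, A (coordF F e) u ≠ 0) ∧
      ∀ e ∈ charts M, ∀ u ∈ coordSet e D,
        B (coordF F e) u = 0 ∧
        vertM (coordF F e) (JY (coordF F e)) u
          = 1 / (coordF F e u : ℂ) * VH (coordF F e) u ∧
        vertM (coordF F e) (VH (coordF F e)) u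
          = -(A (coordF F e) u * JY (coordF F e) u)) ∨
    -- (iii)
    ((∃ e ∈ charts M, ∃ u ∈ coordSet e D, A (coordF F e) u * B (coordF F e) u ^ 2 ≠ 0) ∧
      ∀ e ∈ charts M, ∀ u ∈ coordSet e D,
        vertEta (JY (coordF F e)) u = JY (coordF F e) u / 2 ∧
        vertEta (VH (coordF F e)) u = -(VH (coordF F e) u / 2) ∧
        ∀ k : Fin 2, delta (coordF F e) k (B (coordF F e)) u
          = (B (coordF F e) u / 2 * JY (coordF F e) u
              + vertM (coordF F e) (JY (coordF F e)) u
              - 1 / (coordF F e u : ℂ) * VH (coordF F e) u) * lDn (coordF F e) k u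
            + (B (coordF F e) u * VH (coordF F e) u
              + vertM (coordF F e) (VH (coordF F e)) u
              + A (coordF F e) u * JY (coordF F e) u) * mDn (coordF F e) k u) := by
  have hopen := fun e (he : e ∈ charts M) => isOpen_coordSet he hDopen
  have hsub := fun e : OpenPartialHomeomorph M C2 => coordSet_subset (e := e) hDslit
  have hloc := fun e (he : e ∈ charts M) => hF.isLocalFinsler he
  by_cases hA : ∃ e ∈ charts M, ∃ u ∈ coordSet e D, A (coordF F e) u ≠ 0
  · right
    by_cases hB : ∃ e ∈ charts M, ∃ u ∈ coordSet e D, B (coordF F e) u ≠ 0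
    · right
      refine ⟨?_, fun e he u hu => ⟨(hloc e he).vertEta_JY (hsub e hu),
        (hloc e he).vertEta_VH (hsub e hu), (hloc e he).delta_B (hsub e hu)⟩⟩
      obtain ⟨e, he, u, hu, hBu⟩ := hB
      by_contra! hAB
      refine hBu ((hloc e he).B_eq_zero_of_A_eq_zero (hsub e hu) ?_)
      filter_upwards [(hopen e he).mem_nhds hu,
        (hloc e he).eventually_B_ne_zero (hsub e hu) hBu] with x hx hBx
      simpa [hBx] using hAB e he x hx
    · left
      push Not at hB
      refine ⟨hA, fun e he u hu => ?_⟩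
      have hBu : ∀ᶠ x in nhds u, B (coordF F e) x = 0 := by
        filter_upwards [(hopen e he).mem_nhds hu] with x hx using hB e he x hx
      exact ⟨hB e he u hu, (hloc e he).vertM_JY_of_B_eq_zero (hsub e hu) hBu,
        (hloc e he).vertM_VH_of_B_eq_zero (hsub e hu) hBu⟩
  · left
    push Not at hA
    intro e he z η η' hη hη' i j
    exact (hloc e he).g_eq_of_A_eq_zero (hopen e he) (hsub e) (hA e he)
      (isPreconnected_fibre_coordSet he hDfib hη.1) hη hη' i j
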